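/- **Conventions.** Formulas are first-order formulas in the language $0,S,+,\cdot$ with variables $x_0,x_1,\dots$ and primitive symbols $=,\neg,\wedge,\exists$; $\mathrm{PA}$ consists of the axioms of Robinson arithmetic and the induction scheme. A $\Sigma^0_n$ (resp. $\Pi^0_n$) formula is a $\Delta_0$ formula preceded by $n$ alternating blocks of quantifiers, the first one existential (resp. universal). Fix an effective Gödel numbering $\ulcorner\cdot\urcorner$. For $s,k\in\mathbb N$ let $\mathrm{el}(s,k)$ be the exponent of the $k$-th prime ($p_0=2$) in $s+1$, and let $s[a/k]$ be the number coding the same sequence as $s$ except that its $k$-th entry is $a$. If $M$ is a structure with domain $\mathbb N$, then $M\models\phi[s]$ means that $\phi$ holds in $M$ when each $x_i$ has the value $\mathrm{el}(s,i)$. A *$\Sigma^0_2$-model* is a model $M$ of $\mathrm{PA}$ with domain $\mathbb N$ and $0_M=0$ such that $\{(\ulcorner\phi\urcorner,s) : M\models\phi[s]\}$ is definable in $\mathbb N$ by a $\Sigma^0_2$ formula. Let $\mathrm{Sat}(c,x,y)$ be the natural arithmetical formula saying that $\mathrm{el}(c,0)$ is the Gödel number of a $\Sigma^0_2$ formula which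 is true when $x_0,x_1$ have the values $x,y$ and $x_{i+1}$ has the value $\mathrm{el}(c,i)$ for every $i>0$. A number $m$ is a *code* for the $\Sigma^0_2$-model $M$ if for all formulas $\phi$ and all $s\in\mathbb N$: $M\models\phi[s]\iff\mathbb N\models\mathrm{Sat}(m,\ulcorner\phi\urcorner,s)$. Let $\mathrm{Mod}(m)$ be the formula of arithmetic, obtained by natural arithmetization, which expresses the conjunction of the following. * *$m$ is total:* there is exactly one $y$ with $\mathrm{Sat}(m,\ulcorner 0=x_0\urcorner,0[y/0])$, denoted $0_m$; for all $a,b$ there is exactly one $y$ with $\mathrm{Sat}(m,\ulcorner S(x_0)=x_1\urcorner,0[a/0,y/1])$, denoted $S_m(a)$, exactly one $y$ with $\mathrm{Sat}(m,\ulcorner x_0+x_1=x_2\urcorner,0[a/0,b/1,y/2])$, denoted $a+_mb$, and exactly one $y$ with $\mathrm{Sat}(m,\ulcorner x_0\cdot x_1=x_2\urcorner,0[a/0,b/1,y/2])$, denoted $a\cdot_mb$. * $0_m=0$. * *Tarski's conditions:* for all $i,s$, all (Gödel numbers of) formulas $\phi,\psi$ and all (Gödel numbers of) terms $a,b$: $\mathrm{Sat}(m,\exists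 x_i\phi,s)\leftrightarrow\exists x\,\mathrm{Sat}(m,\phi,s[x/i])$; $\mathrm{Sat}(m,\phi\wedge\psi,s)\leftrightarrow\mathrm{Sat}(m,\phi,s)\wedge\mathrm{Sat}(m,\psi,s)$; $\mathrm{Sat}(m,\neg\phi,s)\leftrightarrow\neg\mathrm{Sat}(m,\phi,s)$; and $\mathrm{Sat}(m,a=b,s)$ holds if and only if $a$ and $b$ have the same value when $x_i$ is evaluated as $\mathrm{el}(s,i)$ and $0,S,+,\cdot$ as $0_m,S_m,+_m,\cdot_m$. * $\mathrm{Sat}(m,\phi,s)$ for every $s$ and every axiom $\phi$ of $\mathrm{PA}$. **Proposition.** 1. $\mathrm{Mod}(m)$ is a $\Pi^0_3$ formula in the free variable $m$; that is, it has no other free variables and is equivalent in $\mathrm{PA}$ to a $\Pi^0_3$ formula with no other free variables. 2. If $M$ is a $\Sigma^0_2$-model and $m$ is a code for $M$, then $\mathbb N\models\mathrm{Mod}(m)$. 3. If $m\in\mathbb N$ and $\mathbb N\models\mathrm{Mod}(m)$, then there is exactly one $\Sigma^0_2$-model $M$ such that, for all formulas $\phi$ and all $s\in\mathbb N$, $M\models\phi[s]\iff\mathbb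 N\models\mathrm{Sat}(m,\ulcorner\phi\urcorner,s)$. -/

import Mathlib

namespace ArithModels

/-! ### Syntax of first-order arithmetic

Terms and formulas over `0, S, +, ·` with named variables `x_0, x_1, …`; the primitive
logical symbols are `=, ¬, ∧, ∃`. -/

/-- Terms in the language `0, S, +, ·` with variables `x_i`. -/
inductive Tm : Type
  | var (i : ℕ) : Tm
  | zero : Tm
  | succ (a : Tm) : Tm
  | add (a b : Tm) : Tm
  | mul (a b : Tm) : Tm

/-- Formulas, with primitive symbols `=, ¬, ∧, ∃`. -/
inductive Fm : Type
  | eq (a b : Tm) : Fm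
  | not (φ : Fm) : Fm
  | and (φ ψ : Fm) : Fm
  | ex (i : ℕ) (φ : Fm) : Fm

instance : Zero Tm := ⟨Tm.zero⟩
instance : Add Tm := ⟨Tm.add⟩
instance : Mul Tm := ⟨Tm.mul⟩

namespace Tm

/-- The numeral `S^n(0)`. -/
def num : ℕ → Tm
  | 0 => zero
  | n + 1 => succ (num n)

/-- The variables of a term. -/
def fv : Tm → Finset ℕ
  | var i => {i}
  | zero => ∅
  | succ a => a.fv
  | add a b => a.fv ∪ b.fv
  | mul a b => a.fv ∪ b.fv

/-- Substitution of the term `t` for the variable `x_i`. -/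
def subst (i : ℕ) (t : Tm) : Tm → Tm
  | var k => if k = i then t else var k
  | zero => zero
  | succ a => succ (subst i t a)
  | add a b => add (subst i t a) (subst i t b)
  | mul a b => mul (subst i t a) (subst i t b)

end Tm

namespace Fm

/-- Disjunction. -/
def or (φ ψ : Fm) : Fm := not (and (not φ) (not ψ))

/-- Implication. -/
def imp (φ ψ : Fm) : Fm := not (and φ (not ψ))

/-- Equivalence. -/
def iff (φ ψ : Fm) : Fm := and (imp φ ψ) (imp ψ φ)

/-- Universal quantification `∀ x_i φ`. -/
def all (i : ℕ) (φ : Fm) : Fm := not (ex i (not φ))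

/-- The free variables of a formula. -/
def fv : Fm → Finset ℕ
  | eq a b => a.fv ∪ b.fv
  | not φ => φ.fv
  | and φ ψ => φ.fv ∪ ψ.fv
  | ex i φ => φ.fv.erase i

/-- Substitution of the term `t` for the free occurrences of `x_i`. It is only used with `t = 0`
and `t = S(x_i)`, for which no variable can be captured. -/
def subst (i : ℕ) (t : Tm) : Fm → Fm
  | eq a b => eq (Tm.subst i t a) (Tm.subst i t b)
  | not φ => not (φ.subst i t)
  | and φ ψ => and (φ.subst i t) (ψ.subst i t)
  | ex k φ => if k = i then ex k φ else ex k (φ.subst i t)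

end Fm

/-! ### Structures and satisfaction -/

/-- A structure `(M; 0_M, S_M, +_M, ·_M)` for the language of arithmetic. -/
structure ArithStr (M : Type*) where
  zero : M
  succ : M → M
  add : M → M → M
  mul : M → M → M

namespace ArithStr

variable {M : Type*}

/-- Value of a term in the environment `e`. -/
def val (S : ArithStr M) (e : ℕ → M) : Tm → M
  | .var i => e i
  | .zero => S.zero
  | .succ a => S.succ (S.val e a)
  | .add a b => S.add (S.val e a) (S.val e b)
  | .mul a b => S.mul (S.val e a) (S.val e b)

/-- Tarskian satisfaction of a formula in the environment `e`. -/
def Sat (S : ArithStr M) : (ℕ → M) → Fm → Prop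
  | e, .eq a b => S.val e a = S.val e b
  | e, .not φ => ¬ S.Sat e φ
  | e, .and φ ψ => S.Sat e φ ∧ S.Sat e ψ
  | e, .ex i φ => ∃ x, S.Sat (Function.update e i x) φ

end ArithStr

/-- The standard model of arithmetic. -/
def stdN : ArithStr ℕ := ⟨0, Nat.succ, fun a b => a + b, fun a b => a * b⟩

/-- The environment assigning the entries of `l` to `x_0, x_1, …` and `0` to the other
variables. -/
def listEnv (l : List ℕ) : ℕ → ℕ := fun i => l.getD i 0

/-! ### Peano arithmetic -/

/-- The axioms of Robinson arithmetic. -/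
def qAxioms : List Fm :=
  let x : Tm := .var 0
  let y : Tm := .var 1
  [ .all 0 (.not (.eq (.succ x) 0)),
    .all 0 (.all 1 (.imp (.eq (.succ x) (.succ y)) (.eq x y))),
    .all 0 (.or (.eq x 0) (.ex 1 (.eq x (.succ y)))),
    .all 0 (.eq (x + 0) x),
    .all 0 (.all 1 (.eq (x + .succ y) (.succ (x + y)))),
    .all 0 (.eq (x * 0) 0),
    .all 0 (.all 1 (.eq (x * .succ y) (x * y + x))) ]

/-- The induction axiom `φ(0) ∧ ∀ x_i (φ(x_i) → φ(S x_i)) → ∀ x_i φ(x_i)`. The other variables of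
`φ` are parameters: axioms are required to hold in all environments. -/
def inductionAx (i : ℕ) (φ : Fm) : Fm :=
  .imp (.and (φ.subst i 0) (.all i (.imp φ (φ.subst i (.succ (.var i)))))) (.all i φ)

/-- The axioms of Peano arithmetic. -/
def PA : Set Fm := {φ | φ ∈ qAxioms ∨ ∃ i ψ, φ = inductionAx i ψ}

/-- `S` is a model of `PA`. -/
def ArithStr.ModelsPA {M : Type*} (S : ArithStr M) : Prop :=
  ∀ φ ∈ PA, ∀ e : ℕ → M, S.Sat e φ

/-- `PA ⊢ φ` (for the universal closure of `φ`), read semantically: `φ` holds in every model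
of `PA`. (By Löwenheim–Skolem it does not matter which universe the models live in.) -/
def PAProves (φ : Fm) : Prop :=
  ∀ (M : Type) (S : ArithStr M), S.ModelsPA → ∀ e : ℕ → M, S.Sat e φ

/-! ### The arithmetical hierarchy -/

/-- `Δ₀` formulas: all quantifiers are bounded. The order is not a primitive symbol, `a ≤ b`
being the formula `∃ x_j (x_j + a = b)`; bounded existential quantification is
`∃ x_i (x_i ≤ t ∧ φ)` with `x_i` not in `t`. -/
inductive IsDelta0 : Fm → Prop
  | eq (a b : Tm) : IsDelta0 (.eq a b)
  | not {φ : Fm} : IsDelta0 φ → IsDelta0 (.not φ)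
  | and {φ ψ : Fm} : IsDelta0 φ → IsDelta0 ψ → IsDelta0 (.and φ ψ)
  | le {j : ℕ} {a b : Tm} : j ∉ a.fv → j ∉ b.fv → IsDelta0 (.ex j (.eq (.var j + a) b))
  | bex {i j : ℕ} {t : Tm} {φ : Fm} : i ∉ t.fv → j ∉ t.fv → j ≠ i → IsDelta0 φ →
      IsDelta0 (.ex i (.and (.ex j (.eq (.var j + .var i) t)) φ))

mutual
/-- `Σ⁰_n` formulas: `Δ₀` for `n = 0`; a block of existential quantifiers before a `Π⁰_n` formula
for `n + 1`. -/
inductive IsSigma : ℕ → Fm → Prop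
  | zero {φ : Fm} : IsDelta0 φ → IsSigma 0 φ
  | ofPi {n : ℕ} {φ : Fm} : IsPi n φ → IsSigma (n + 1) φ
  | ex {n : ℕ} {φ : Fm} (i : ℕ) : IsSigma (n + 1) φ → IsSigma (n + 1) (.ex i φ)
/-- `Π⁰_n` formulas: `Δ₀` for `n = 0`; a block of universal quantifiers before a `Σ⁰_n` formula
for `n + 1`. -/
inductive IsPi : ℕ → Fm → Prop
  | zero {φ : Fm} : IsDelta0 φ → IsPi 0 φ
  | ofSigma {n : ℕ} {φ : Fm} : IsSigma n φ → IsPi (n + 1) φ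
  | all {n : ℕ} {φ : Fm} (i : ℕ) : IsPi (n + 1) φ → IsPi (n + 1) (.all i φ)
end

/-- The set of pairs `R ⊆ ℕ × ℕ` is arithmetical of complexity `Σ⁰_n`. -/
def SigmaDefinablePairs (n : ℕ) (R : Set (ℕ × ℕ)) : Prop :=
  ∃ ψ : Fm, IsSigma n ψ ∧ ψ.fv ⊆ {0, 1} ∧
    ∀ a b : ℕ, (a, b) ∈ R ↔ stdN.Sat (listEnv [a, b]) ψ

/-! ### Gödel numbers -/

/-- The injective pairing `(a + b)² + a`, strictly increasing in both arguments. -/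
def pr (a b : ℕ) : ℕ := (a + b) * (a + b) + a

/-- Gödel number of a term. -/
def Tm.gn : Tm → ℕ
  | .var i => pr 1 i
  | .zero => pr 2 0
  | .succ a => pr 3 a.gn
  | .add a b => pr 4 (pr a.gn b.gn)
  | .mul a b => pr 5 (pr a.gn b.gn)

/-- Gödel number of a formula. -/
def Fm.gn : Fm → ℕ
  | .eq a b => pr 6 (pr a.gn b.gn)
  | .not φ => pr 7 φ.gn
  | .and φ ψ => pr 8 (pr φ.gn ψ.gn)
  | .ex i φ => pr 9 (pr i φ.gn)

/-! ### Models with domain `ℕ` -/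

/-- `el s k` is the exponent of the `k`-th prime (`p_0 = 2`) in `s + 1`. Thus `s` codes the
finitely supported sequence `el s 0, el s 1, …`. -/
noncomputable def el (s k : ℕ) : ℕ := (s + 1).factorization (Nat.nth Nat.Prime k)

/-- `M ⊨ φ[s]`: the formula `φ` holds in `M` in the environment coded by `s`. -/
def ArithStr.SatCode (S : ArithStr ℕ) (φ : Fm) (s : ℕ) : Prop := S.Sat (el s) φ

/-- `Σ⁰₂`-models of `PA`: models with domain `ℕ` whose satisfaction relation is `Σ⁰₂`; the
constant `0` is required to be interpreted by the number `0`. -/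
structure IsSigma2Model (S : ArithStr ℕ) : Prop where
  models : S.ModelsPA
  zero_eq : S.zero = 0
  sigma2 : SigmaDefinablePairs 2 {q | ∃ (φ : Fm) (s : ℕ), q = (φ.gn, s) ∧ S.SatCode φ s}

/-! ### Building arithmetical formulas

To write long formulas of arithmetic without choosing bound variables by hand, a formula is given
as a function of the least index `n` such that no `x_k` with `k ≥ n` has been used so far; a
quantifier binds `x_n` and passes `n + 1` to its scope. -/

/-- Formulas depending on the next unused variable index. -/
abbrev Bd : Type := ℕ → Fm

/-- Equality of terms. -/
def eqB (a b : Tm) : Bd := fun _ => .eq a b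
/-- Negation. -/
def notB (f : Bd) : Bd := fun n => .not (f n)
/-- Conjunction. -/
def andB (f g : Bd) : Bd := fun n => .and (f n) (g n)
/-- Disjunction. -/
def orB (f g : Bd) : Bd := fun n => .or (f n) (g n)
/-- Implication. -/
def impB (f g : Bd) : Bd := fun n => .imp (f n) (g n)
/-- Equivalence. -/
def iffB (f g : Bd) : Bd := fun n => .iff (f n) (g n)
/-- Existential quantification. -/
def exB (f : Tm → Bd) : Bd := fun n => .ex n (f (.var n) (n + 1))
/-- Universal quantification. -/
def allB (f : Tm → Bd) : Bd := fun n => .all n (f (.var n) (n + 1))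

infix:80 " ≐ " => eqB
infixr:75 " ⩓ " => andB
infixr:70 " ⩔ " => orB
infixr:65 " ⇛ " => impB
infix:60 " ⇚⇛ " => iffB

/-- `a ≤ b`. -/
def leB (a b : Tm) : Bd := exB fun z => (z + a) ≐ b
/-- `a < b`. -/
def ltB (a b : Tm) : Bd := leB (.succ a) b
/-- `∃ x ≤ t, f x`. -/
def bexB (t : Tm) (f : Tm → Bd) : Bd := exB fun x => leB x t ⩓ f x
/-- `∀ x ≤ t, f x`. -/
def ballB (t : Tm) (f : Tm → Bd) : Bd := notB (bexB t fun x => notB (f x))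

/-- Gödel's `β` function: `v` is the remainder of `c` modulo `1 + (i + 1) d`. -/
def betaB (c d i v : Tm) : Bd :=
  (bexB c fun q => c ≐ (q * .succ (.succ i * d) + v)) ⩓ leB v (.succ i * d)

/-- `x` is derivable by the rule `step`: there is a finite sequence (coded by `β`) with last
entry `x`, each entry `y` of which satisfies `step prev y`, where `prev z` says that `z` is an
earlier entry. All recursive definitions below are formalized in this way. -/
def derivB (step : (Tm → Bd) → Tm → Bd) (x : Tm) : Bd :=
  exB fun c => exB fun d => exB fun n => betaB c d n x ⩓
    ballB n fun k => exB fun y => betaB c d k y ⩓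
      step (fun z => bexB k fun j => ltB j k ⩓ betaB c d j z) y

/-! ### Primes, powers and coded sequences inside arithmetic -/

/-- `p` divides `u`. -/
def dvdB (p u : Tm) : Bd := bexB u fun q => (q * p) ≐ u
/-- `p` is prime. -/
def primeB (p : Tm) : Bd :=
  leB (.num 2) p ⩓ ballB p fun q => dvdB q p ⇛ (q ≐ .num 1 ⩔ q ≐ p)
/-- `q` is the least prime above `p`. -/
def nextPrimeB (p q : Tm) : Bd :=
  ltB p q ⩓ primeB q ⩓ ballB q fun r => (ltB p r ⩓ primeB r) ⇛ r ≐ q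

/-- The pairing as a term. -/
def prT (a b : Tm) : Tm := (a + b) * (a + b) + a

/-- `p ^ e = v`, by `p ^ 0 = 1`, `p ^ (e + 1) = p ^ e · p`. -/
def powB (p e v : Tm) : Bd :=
  derivB (fun prev y => y ≐ prT 0 (.num 1) ⩔
    exB fun i => exB fun w => prev (prT i w) ⩓ y ≐ prT (.succ i) (w * p)) (prT e v)

/-- `p` is the `k`-th prime `p_k`, where `p_0 = 2`. -/
def nthPrimeB (k p : Tm) : Bd :=
  derivB (fun prev y => y ≐ prT 0 (.num 2) ⩔
    exB fun i => exB fun q => exB fun r =>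
      prev (prT i q) ⩓ nextPrimeB q r ⩓ y ≐ prT (.succ i) r) (prT k p)

/-- `el(s, k) = a`: `s + 1 = u · p_k ^ a` with `u` not divisible by `p_k`. -/
def elB (s k a : Tm) : Bd :=
  exB fun p => exB fun u => exB fun v =>
    nthPrimeB k p ⩓ powB p a v ⩓ (.succ s ≐ (u * v)) ⩓ notB (dvdB p u)

/-- `t = s[a/k]`: `t` codes the same sequence as `s`, except that the `k`-th entry is `a`. -/
def updB (s a k t : Tm) : Bd :=
  exB fun p => exB fun u => exB fun e => exB fun v => exB fun w =>
    nthPrimeB k p ⩓ powB p e v ⩓ powB p a w ⩓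
      (.succ s ≐ (u * v)) ⩓ notB (dvdB p u) ⩓ (.succ t ≐ (u * w))

/-! ### Arithmetized syntax

The functions on Gödel numbers corresponding to the formation rules are polynomials, hence terms
of the language. -/

/-- `i ↦ ⌜x_i⌝`. -/
def cVar (i : Tm) : Tm := prT (.num 1) i
/-- `⌜0⌝`. -/
def cZero : Tm := prT (.num 2) 0
/-- `⌜a⌝ ↦ ⌜S(a)⌝`. -/
def cSucc (a : Tm) : Tm := prT (.num 3) a
/-- `⌜a⌝, ⌜b⌝ ↦ ⌜a + b⌝`. -/
def cAdd (a b : Tm) : Tm := prT (.num 4) (prT a b)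
/-- `⌜a⌝, ⌜b⌝ ↦ ⌜a · b⌝`. -/
def cMul (a b : Tm) : Tm := prT (.num 5) (prT a b)
/-- `⌜a⌝, ⌜b⌝ ↦ ⌜a = b⌝`. -/
def cEq (a b : Tm) : Tm := prT (.num 6) (prT a b)
/-- `⌜φ⌝ ↦ ⌜¬ φ⌝`. -/
def cNot (φ : Tm) : Tm := prT (.num 7) φ
/-- `⌜φ⌝, ⌜ψ⌝ ↦ ⌜φ ∧ ψ⌝`. -/
def cAnd (φ ψ : Tm) : Tm := prT (.num 8) (prT φ ψ)
/-- `i, ⌜φ⌝ ↦ ⌜∃ x_i φ⌝`. -/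
def cEx (i φ : Tm) : Tm := prT (.num 9) (prT i φ)
/-- `⌜φ⌝, ⌜ψ⌝ ↦ ⌜φ → ψ⌝`. -/
def cImp (φ ψ : Tm) : Tm := cNot (cAnd φ (cNot ψ))
/-- `i, ⌜φ⌝ ↦ ⌜∀ x_i φ⌝`. -/
def cAll (i φ : Tm) : Tm := cNot (cEx i (cNot φ))

/-- A closed term whose value is the Gödel number of the term `a`. -/
def quoteT : Tm → Tm
  | .var i => cVar (.num i)
  | .zero => cZero
  | .succ a => cSucc (quoteT a)
  | .add a b => cAdd (quoteT a) (quoteT b)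
  | .mul a b => cMul (quoteT a) (quoteT b)

/-- A closed term whose value is the Gödel number of the formula `φ`. -/
def quoteF : Fm → Tm
  | .eq a b => cEq (quoteT a) (quoteT b)
  | .not φ => cNot (quoteF φ)
  | .and φ ψ => cAnd (quoteF φ) (quoteF ψ)
  | .ex i φ => cEx (.num i) (quoteF φ)

/-- `x` codes a term all of whose variables `x_k` satisfy `P k`. -/
def tmWithB (P : Tm → Bd) (x : Tm) : Bd :=
  derivB (fun prev y =>
    (exB fun k => P k ⩓ y ≐ cVar k) ⩔
    (y ≐ cZero) ⩔
    (exB fun a => prev a ⩓ y ≐ cSucc a) ⩔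
    (exB fun a => exB fun b => prev a ⩓ prev b ⩓ (y ≐ cAdd a b ⩔ y ≐ cMul a b))) x

/-- `x` codes a term. -/
def tmB (x : Tm) : Bd := tmWithB (fun k => k ≐ k) x

/-- `x` codes a term in which the variable `x_j` does not occur. -/
def tmWithoutB (j x : Tm) : Bd := tmWithB (fun k => notB (k ≐ j)) x

/-- `x` codes a formula. -/
def fmB (x : Tm) : Bd :=
  derivB (fun prev y =>
    (exB fun a => exB fun b => tmB a ⩓ tmB b ⩓ y ≐ cEq a b) ⩔
    (exB fun φ => prev φ ⩓ y ≐ cNot φ) ⩔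
    (exB fun φ => exB fun ψ => prev φ ⩓ prev ψ ⩓ y ≐ cAnd φ ψ) ⩔
    (exB fun i => exB fun φ => prev φ ⩓ y ≐ cEx i φ)) x

/-- Recursion on arithmetized terms: `x` codes a term whose value is `v` when variables, `0`,
successor, addition and multiplication are evaluated according to the (graphs of the) functions
`E, Z, F, A, P`. -/
def recB (E : Tm → Tm → Bd) (Z : Tm → Bd) (F : Tm → Tm → Bd) (A P : Tm → Tm → Tm → Bd)
    (x v : Tm) : Bd :=
  derivB (fun prev y =>
    (exB fun k => exB fun w => E k w ⩓ y ≐ prT (cVar k) w) ⩔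
    (exB fun w => Z w ⩓ y ≐ prT cZero w) ⩔
    (exB fun a => exB fun u => exB fun w =>
      prev (prT a u) ⩓ F u w ⩓ y ≐ prT (cSucc a) w) ⩔
    (exB fun a => exB fun b => exB fun u => exB fun u₂ => exB fun w =>
      prev (prT a u) ⩓ prev (prT b u₂) ⩓
        ((A u u₂ w ⩓ y ≐ prT (cAdd a b) w) ⩔ (P u u₂ w ⩓ y ≐ prT (cMul a b) w)))) (prT x v)

/-- `v` codes the result of substituting the term coded by `t` for `x_i` in the term coded
by `x`. -/
def substTB (i t x v : Tm) : Bd :=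
  recB (fun k w => (k ≐ i ⩓ w ≐ t) ⩔ (notB (k ≐ i) ⩓ w ≐ cVar k)) (fun w => w ≐ cZero)
    (fun u w => w ≐ cSucc u) (fun u u₂ w => w ≐ cAdd u u₂) (fun u u₂ w => w ≐ cMul u u₂) x v

/-- `v` codes the result of substituting the term coded by `t` for the free occurrences of `x_i`
in the formula coded by `x`. -/
def substFB (i t x v : Tm) : Bd :=
  derivB (fun prev y =>
    (exB fun a => exB fun b => exB fun a₂ => exB fun b₂ =>
      substTB i t a a₂ ⩓ substTB i t b b₂ ⩓ y ≐ prT (cEq a b) (cEq a₂ b₂)) ⩔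
    (exB fun φ => exB fun φ₂ => prev (prT φ φ₂) ⩓ y ≐ prT (cNot φ) (cNot φ₂)) ⩔
    (exB fun φ => exB fun ψ => exB fun φ₂ => exB fun ψ₂ =>
      prev (prT φ φ₂) ⩓ prev (prT ψ ψ₂) ⩓ y ≐ prT (cAnd φ ψ) (cAnd φ₂ ψ₂)) ⩔
    (exB fun φ => fmB φ ⩓ y ≐ prT (cEx i φ) (cEx i φ)) ⩔
    (exB fun k => exB fun φ => exB fun φ₂ =>
      notB (k ≐ i) ⩓ prev (prT φ φ₂) ⩓ y ≐ prT (cEx k φ) (cEx k φ₂))) (prT x v)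

/-- `x` codes an axiom of `PA`. -/
def axPAB (x : Tm) : Bd :=
  (qAxioms.foldr (fun φ f => x ≐ quoteF φ ⩔ f) (0 ≐ .num 1)) ⩔
  (exB fun i => exB fun φ => exB fun φ₀ => exB fun φ₁ =>
    fmB φ ⩓ substFB i cZero φ φ₀ ⩓ substFB i (cSucc (cVar i)) φ φ₁ ⩓
      x ≐ cImp (cAnd φ₀ (cAll i (cImp φ φ₁))) (cAll i φ))

/-! ### The `Σ⁰₂` satisfaction predicate inside arithmetic -/

/-- The code of the formula `∃ x_j (x_j + a = b)`, i.e. `a ≤ b`. -/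
def cLe (j a b : Tm) : Tm := cEx j (cEq (cAdd (cVar j) a) b)

/-- The code of the bounded quantification `∃ x_i (x_i ≤ t ∧ φ)`. -/
def cBex (i j t φ : Tm) : Tm := cEx i (cAnd (cLe j (cVar i) t) φ)

/-- `x` codes a `Δ₀` formula. -/
def delta0B (x : Tm) : Bd :=
  derivB (fun prev y =>
    (exB fun a => exB fun b => tmB a ⩓ tmB b ⩓ y ≐ cEq a b) ⩔
    (exB fun φ => prev φ ⩓ y ≐ cNot φ) ⩔
    (exB fun φ => exB fun ψ => prev φ ⩓ prev ψ ⩓ y ≐ cAnd φ ψ) ⩔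
    (exB fun j => exB fun a => exB fun b =>
      tmWithoutB j a ⩓ tmWithoutB j b ⩓ y ≐ cLe j a b) ⩔
    (exB fun i => exB fun j => exB fun t => exB fun φ =>
      tmWithoutB i t ⩓ tmWithoutB j t ⩓ notB (j ≐ i) ⩓ prev φ ⩓ y ≐ cBex i j t φ)) x

/-- The term coded by `x` has value `v` (in the standard sense) in the environment coded
by `s`. -/
def tvalB (s x v : Tm) : Bd :=
  recB (fun k w => elB s k w) (fun w => w ≐ 0) (fun u w => w ≐ .succ u)
    (fun u u₂ w => w ≐ (u + u₂)) (fun u u₂ w => w ≐ (u * u₂)) x v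

/-- The `Δ₀` formula coded by `x` has truth value `v` (`1` for true, `0` for false) in the
environment coded by `s`. -/
def truthB (x s v : Tm) : Bd :=
  derivB (fun prev y =>
    (exB fun a => exB fun b => exB fun e => exB fun u => exB fun w =>
      tvalB e a u ⩓ tvalB e b w ⩓
        ((u ≐ w ⩓ y ≐ prT (prT (cEq a b) e) (.num 1)) ⩔
          (notB (u ≐ w) ⩓ y ≐ prT (prT (cEq a b) e) 0))) ⩔
    (exB fun φ => exB fun e =>
      (prev (prT (prT φ e) 0) ⩓ y ≐ prT (prT (cNot φ) e) (.num 1)) ⩔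
        (prev (prT (prT φ e) (.num 1)) ⩓ y ≐ prT (prT (cNot φ) e) 0)) ⩔
    (exB fun φ => exB fun ψ => exB fun e =>
      (prev (prT (prT φ e) (.num 1)) ⩓ prev (prT (prT ψ e) (.num 1)) ⩓
          y ≐ prT (prT (cAnd φ ψ) e) (.num 1)) ⩔
        ((prev (prT (prT φ e) 0) ⩔ prev (prT (prT ψ e) 0)) ⩓
          y ≐ prT (prT (cAnd φ ψ) e) 0)) ⩔
    (exB fun j => exB fun a => exB fun b => exB fun e => exB fun u => exB fun w =>
      tmWithoutB j a ⩓ tmWithoutB j b ⩓ tvalB e a u ⩓ tvalB e b w ⩓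
        ((leB u w ⩓ y ≐ prT (prT (cLe j a b) e) (.num 1)) ⩔
          (ltB w u ⩓ y ≐ prT (prT (cLe j a b) e) 0))) ⩔
    (exB fun i => exB fun j => exB fun t => exB fun φ => exB fun e => exB fun w =>
      tmWithoutB i t ⩓ tmWithoutB j t ⩓ notB (j ≐ i) ⩓ tvalB e t w ⩓
        (((bexB w fun z => exB fun e₂ => updB e z i e₂ ⩓ prev (prT (prT φ e₂) (.num 1))) ⩓
            y ≐ prT (prT (cBex i j t φ) e) (.num 1)) ⩔
          ((ballB w fun z => exB fun e₂ => updB e z i e₂ ⩓ prev (prT (prT φ e₂) 0)) ⩓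
            y ≐ prT (prT (cBex i j t φ) e) 0)))) (prT (prT x s) v)

/-- Removing a block of existential quantifiers from the formula coded by `x` and changing the
environment coded by `s` at the quantified variables gives `x₂` and `s₂`. -/
def stripExB (x s x₂ s₂ : Tm) : Bd :=
  derivB (fun prev y => y ≐ prT x s ⩔
    (exB fun i => exB fun φ => exB fun e => exB fun z => exB fun e₂ =>
      prev (prT (cEx i φ) e) ⩓ updB e z i e₂ ⩓ y ≐ prT φ e₂)) (prT x₂ s₂)

/-- Removing a block of universal quantifiers from the formula coded by `x` and changing the
environment coded by `s` at the quantified variables gives `x₂` and `s₂`. -/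
def stripAllB (x s x₂ s₂ : Tm) : Bd :=
  derivB (fun prev y => y ≐ prT x s ⩔
    (exB fun i => exB fun φ => exB fun e => exB fun z => exB fun e₂ =>
      prev (prT (cAll i φ) e) ⩓ updB e z i e₂ ⩓ y ≐ prT φ e₂)) (prT x₂ s₂)

/-- `x` codes a `Π⁰₁` formula which is true in the environment coded by `s`. -/
def satPi1B (x s : Tm) : Bd :=
  (exB fun x₂ => exB fun s₂ => stripAllB x s x₂ s₂ ⩓ delta0B x₂) ⩓
  (allB fun x₂ => allB fun s₂ =>
    (stripAllB x s x₂ s₂ ⩓ delta0B x₂) ⇛ notB (truthB x₂ s₂ 0))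

/-- `x` codes a `Σ⁰₂` formula which is true in the environment coded by `s`. -/
def satSigma2B (x s : Tm) : Bd :=
  exB fun x₂ => exB fun s₂ => stripExB x s x₂ s₂ ⩓ satPi1B x₂ s₂

/-- The formula `Sat(c, x, y)`: the entry `(c)_0` codes a `Σ⁰₂` formula which is true when
`x_0, x_1` have the values `x, y`, and `x_{i+1}` has the value `(c)_i` for `i > 0`. So `c` codes
the binary predicate defined by `(c)_0` with parameters `(c)_1, (c)_2, …`. (In the bounded
quantifier, the entries of `c` and `t` beyond the bound vanish.) -/
def satB (c x y : Tm) : Bd :=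
  exB fun f => exB fun t =>
    elB c 0 f ⩓ elB t 0 x ⩓ elB t (.num 1) y ⩓
    (ballB (c + t) fun i => ltB 0 i ⇛ exB fun v => elB c i v ⩓ elB t (.succ i) v) ⩓
    satSigma2B f t

/-! ### Codes of models -/

/-- `Sat(m, ⌜φ⌝, s[a/0])` with `s = 0`. -/
def satAt1 (m : Tm) (φ : Fm) (a : Tm) : Bd :=
  exB fun t => updB 0 a 0 t ⩓ satB m (quoteF φ) t

/-- `Sat(m, ⌜φ⌝, s[a/0, b/1])` with `s = 0`. -/
def satAt2 (m : Tm) (φ : Fm) (a b : Tm) : Bd :=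
  exB fun t => exB fun t₂ => updB 0 a 0 t ⩓ updB t b (.num 1) t₂ ⩓ satB m (quoteF φ) t₂

/-- `Sat(m, ⌜φ⌝, s[a/0, b/1, c/2])` with `s = 0`. -/
def satAt3 (m : Tm) (φ : Fm) (a b c : Tm) : Bd :=
  exB fun t => exB fun t₂ => exB fun t₃ =>
    updB 0 a 0 t ⩓ updB t b (.num 1) t₂ ⩓ updB t₂ c (.num 2) t₃ ⩓ satB m (quoteF φ) t₃

/-- `0_m = y`, if `m` is total. -/
def zeroMB (m y : Tm) : Bd := satAt1 m (.eq 0 (.var 0)) y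
/-- `S_m(a) = y`, if `m` is total. -/
def succMB (m a y : Tm) : Bd := satAt2 m (.eq (.succ (.var 0)) (.var 1)) a y
/-- `a +_m b = y`, if `m` is total. -/
def addMB (m a b y : Tm) : Bd := satAt3 m (.eq (.var 0 + .var 1) (.var 2)) a b y
/-- `a ·_m b = y`, if `m` is total. -/
def mulMB (m a b y : Tm) : Bd := satAt3 m (.eq (.var 0 * .var 1) (.var 2)) a b y

/-- There is exactly one `y` with `f y`. -/
def existsUniqueB (f : Tm → Bd) : Bd :=
  (exB fun y => f y) ⩓ allB fun y => allB fun z => (f y ⩓ f z) ⇛ y ≐ z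

/-- `m` is total: `0_m, S_m, +_m, ·_m` are total functions. -/
def totalB (m : Tm) : Bd :=
  existsUniqueB (fun y => zeroMB m y) ⩓
  (allB fun a => existsUniqueB fun y => succMB m a y) ⩓
  (allB fun a => allB fun b => existsUniqueB fun y => addMB m a b y) ⩓
  (allB fun a => allB fun b => existsUniqueB fun y => mulMB m a b y)

/-- `val(x, m, s) = v`: the value of the arithmetized term `x` with respect to
`0_m, S_m, +_m, ·_m` in the environment coded by `s`. -/
def valMB (m s x v : Tm) : Bd :=
  recB (fun k w => elB s k w) (fun w => zeroMB m w) (fun u w => succMB m u w)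
    (fun u u₂ w => addMB m u u₂ w) (fun u u₂ w => mulMB m u u₂ w) x v

/-- The predicate `Mod(m)`: `m` is total, `0_m = 0`, the relation `Sat(m, ·, ·)` satisfies
Tarski's truth conditions for arithmetized formulas, and it contains the axioms of `PA`. -/
def modB (m : Tm) : Bd :=
  totalB m ⩓
  zeroMB m 0 ⩓
  (allB fun i => allB fun φ => allB fun s => fmB φ ⇛
    (satB m (cEx i φ) s ⇚⇛ exB fun x => exB fun t => updB s x i t ⩓ satB m φ t)) ⩓
  (allB fun φ => allB fun ψ => allB fun s => (fmB φ ⩓ fmB ψ) ⇛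
    (satB m (cAnd φ ψ) s ⇚⇛ satB m φ s ⩓ satB m ψ s)) ⩓
  (allB fun φ => allB fun s => fmB φ ⇛ (satB m (cNot φ) s ⇚⇛ notB (satB m φ s))) ⩓
  (allB fun a => allB fun b => allB fun s => (tmB a ⩓ tmB b) ⇛
    (satB m (cEq a b) s ⇚⇛ exB fun v => valMB m s a v ⩓ valMB m s b v)) ⩓
  (allB fun φ => allB fun s => (fmB φ ⩓ axPAB φ) ⇛ satB m φ s)

/-- `Sat(x_0, x_1, x_2)` as a formula of arithmetic. -/
def satFm : Fm := satB (.var 0) (.var 1) (.var 2) 3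

/-- `Mod(x_0)` as a formula of arithmetic. -/
def modFm : Fm := modB (.var 0) 1

/-- `m` is a code for the model `S`: for all `φ` and `s`, `S ⊨ φ[s]` if and only if
`ℕ ⊨ Sat(m, ⌜φ⌝, s)`. -/
def IsCode (m : ℕ) (S : ArithStr ℕ) : Prop :=
  ∀ (φ : Fm) (s : ℕ), S.SatCode φ s ↔ stdN.Sat (listEnv [m, φ.gn, s]) satFm

end ArithModels

namespace ArithModels

open Function

/-! ### Bounds for variables, coincidence, substitution, renaming -/

-- The complexity bound rests on closure properties of the arithmetical hierarchy over PA. The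
-- classes `Sg k n` are defined semantically, uniformly in all models of PA, with one quantifier per
-- block in front of a Δ₀ matrix. `Sg.closed` shows that every level is closed under conjunction,
-- disjunction and bounded quantifiers. Two unbounded quantifiers of the same kind contract to one,
-- because `x + y` bounds both `x` and `y`. A bounded universal quantifier moves past an unbounded
-- existential one by `collection`, which is proved by induction inside the model. After that,
-- complexity is read off formulas from the inside out. Derivations coded by β are Σ₁. Truth of Π₁
-- formulas is a Σ₁ condition together with a Π₁ condition, hence Σ₂, and so `Sat` is Σ₂. Every
-- clause of `Mod` is a Boolean combination of Σ₂ formulas, possibly guarded by a Σ₁ condition such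
-- as "is a formula", under universal quantifiers, and is therefore Π₃ (`not_modB`).
--
-- The two semantic statements need an evaluation of `Mod` in ℕ. Here `Sat` is a black box: nothing
-- about its meaning as a truth predicate enters, only that its truth depends on the values of its
-- three arguments and not on the choice of bound variables (`sat_satB`). The other ingredients
-- (primes, coded sequences, terms, formulas, substitution, axioms, values of terms) are evaluated
-- through `sat_derivB`, which replaces a β-coded derivation by an actual finite sequence. The
-- result is `sat_modB`. Totality of `m` amounts to the existence of a structure `S` whose
-- operations have the graphs given by `m` (`sat_totalB`), and relative to `S` the remaining clauses
-- are the Tarski conditions over genuine formulas.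
--
-- If `m` codes a model, these clauses are the definition of satisfaction plus the truth of PA.
-- Conversely, induction on formulas turns the Tarski conditions into agreement of `SatN m` with
-- satisfaction in `S`. The axioms then hold in all coded environments, hence in all environments,
-- since a formula has only finitely many free variables. The satisfaction relation is Σ₂ because
-- `Sat` is. Uniqueness holds because four particular formulas determine zero and the operations
-- (`Interprets.unique`).

/-- The least `n` such that all variables of the term have index below `n`. -/
def Tm.bd : Tm → ℕ
  | .var i => i + 1
  | .zero => 0
  | .succ a => a.bd
  | .add a b => max a.bd b.bd
  | .mul a b => max a.bd b.bd

@[simp] theorem Tm.bd_var (i : ℕ) : (Tm.var i).bd = i + 1 := rfl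
@[simp] theorem Tm.bd_succ (a : Tm) : a.succ.bd = a.bd := rfl

@[simp] theorem Tm.bd_num (k : ℕ) : (Tm.num k).bd = 0 := by
  induction k with
  | zero => rfl
  | succ k ih => simpa [Tm.num] using ih

theorem Tm.lt_bd {t : Tm} {i : ℕ} (h : i ∈ t.fv) : i < t.bd := by
  induction t with
  | var k => simp [Tm.fv] at h; simp [h]
  | zero => simp [Tm.fv] at h
  | succ a ih => exact ih h
  | add a b iha ihb | mul a b iha ihb =>
    simp only [Tm.fv, Finset.mem_union] at h
    rcases h with h | h
    · exact lt_of_lt_of_le (iha h) (le_max_left _ _)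
    · exact lt_of_lt_of_le (ihb h) (le_max_right _ _)

namespace ArithStr

variable {M : Type*} (S : ArithStr M)

@[simp] theorem val_var (e : ℕ → M) (i : ℕ) : S.val e (.var i) = e i := rfl
@[simp] theorem val_zero (e : ℕ → M) : S.val e 0 = S.zero := rfl
@[simp] theorem val_zero' (e : ℕ → M) : S.val e .zero = S.zero := rfl
@[simp] theorem val_succ (e : ℕ → M) (a : Tm) : S.val e a.succ = S.succ (S.val e a) := rfl
@[simp] theorem val_add (e : ℕ → M) (a b : Tm) :
    S.val e (a + b) = S.add (S.val e a) (S.val e b) := rfl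
@[simp] theorem val_mul (e : ℕ → M) (a b : Tm) :
    S.val e (a * b) = S.mul (S.val e a) (S.val e b) := rfl
@[simp] theorem val_add' (e : ℕ → M) (a b : Tm) :
    S.val e (a.add b) = S.add (S.val e a) (S.val e b) := rfl
@[simp] theorem val_mul' (e : ℕ → M) (a b : Tm) :
    S.val e (a.mul b) = S.mul (S.val e a) (S.val e b) := rfl

@[simp] theorem sat_eq (e : ℕ → M) (a b : Tm) : S.Sat e (.eq a b) ↔ S.val e a = S.val e b := by
  simp [Sat]
@[simp] theorem sat_not (e : ℕ → M) (φ : Fm) : S.Sat e (.not φ) ↔ ¬ S.Sat e φ := by simp [Sat]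
@[simp] theorem sat_and (e : ℕ → M) (φ ψ : Fm) :
    S.Sat e (.and φ ψ) ↔ S.Sat e φ ∧ S.Sat e ψ := by simp [Sat]
@[simp] theorem sat_ex (e : ℕ → M) (i : ℕ) (φ : Fm) :
    S.Sat e (.ex i φ) ↔ ∃ x, S.Sat (update e i x) φ := by simp [Sat]
@[simp] theorem sat_or (e : ℕ → M) (φ ψ : Fm) :
    S.Sat e (.or φ ψ) ↔ S.Sat e φ ∨ S.Sat e ψ := by simp [Fm.or]; tauto
@[simp] theorem sat_imp (e : ℕ → M) (φ ψ : Fm) :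
    S.Sat e (.imp φ ψ) ↔ (S.Sat e φ → S.Sat e ψ) := by simp [Fm.imp]
@[simp] theorem sat_iff (e : ℕ → M) (φ ψ : Fm) :
    S.Sat e (.iff φ ψ) ↔ (S.Sat e φ ↔ S.Sat e ψ) := by simp [Fm.iff]; tauto
@[simp] theorem sat_all (e : ℕ → M) (i : ℕ) (φ : Fm) :
    S.Sat e (.all i φ) ↔ ∀ x, S.Sat (update e i x) φ := by simp [Fm.all]

theorem val_congr {e e' : ℕ → M} {t : Tm} (h : ∀ i ∈ t.fv, e i = e' i) :
    S.val e t = S.val e' t := by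
  induction t with
  | var k => exact h k (by simp [Tm.fv])
  | zero => rfl
  | succ a ih => simp only [val_succ, ih h]
  | add a b iha ihb | mul a b iha ihb =>
    simp only [Tm.fv, Finset.mem_union] at h
    simp only [val, iha fun i hi => h i (.inl hi), ihb fun i hi => h i (.inr hi)]

theorem sat_congr {φ : Fm} : ∀ {e e' : ℕ → M}, (∀ i ∈ φ.fv, e i = e' i) →
    (S.Sat e φ ↔ S.Sat e' φ) := by
  induction φ with
  | eq a b =>
    intro e e' h
    simp only [Fm.fv, Finset.mem_union] at h
    rw [sat_eq, sat_eq, S.val_congr fun i hi => h i (.inl hi),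
      S.val_congr fun i hi => h i (.inr hi)]
  | not φ ih => intro e e' h; rw [sat_not, sat_not, ih h]
  | and φ ψ ih₁ ih₂ =>
    intro e e' h
    simp only [Fm.fv, Finset.mem_union] at h
    rw [sat_and, sat_and, ih₁ fun i hi => h i (.inl hi), ih₂ fun i hi => h i (.inr hi)]
  | ex k φ ih =>
    intro e e' h
    simp only [sat_ex]
    refine exists_congr fun x => ih fun i hi => ?_
    by_cases hk : i = k
    · simp [hk]
    · simp only [update_of_ne hk]
      exact h i (by simp [Fm.fv, hk, hi])

theorem val_update_of_bd {t : Tm} {i : ℕ} (h : t.bd ≤ i) (e : ℕ → M) (x : M) :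
    S.val (update e i x) t = S.val e t :=
  S.val_congr fun k hk => update_of_ne (by have := Tm.lt_bd hk; omega) _ _

theorem val_subst (e : ℕ → M) (i : ℕ) (t a : Tm) :
    S.val e (Tm.subst i t a) = S.val (update e i (S.val e t)) a := by
  induction a with
  | var k =>
    by_cases h : k = i
    · simp [Tm.subst, h]
    · simp [Tm.subst, h]
  | zero => rfl
  | succ a ih => simp [Tm.subst, ih]
  | add a b iha ihb | mul a b iha ihb => simp [Tm.subst, iha, ihb]

/-- The hypothesis on `t` excludes capture: substitution only passes quantifiers over `x_k` with `k
≠ i`, and such an `x_k` does not occur in `t`. Below a quantifier over `x_i` itself, the new value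
of `x_i` is overwritten anyway. -/
theorem sat_subst {i : ℕ} {t : Tm} (ht : t.fv ⊆ {i}) (φ : Fm) : ∀ e : ℕ → M,
    (S.Sat e (φ.subst i t) ↔ S.Sat (update e i (S.val e t)) φ) := by
  induction φ with
  | eq a b => intro e; simp [Fm.subst, val_subst]
  | not φ ih => intro e; simp [Fm.subst, ih]
  | and φ ψ ih₁ ih₂ => intro e; simp [Fm.subst, ih₁, ih₂]
  | ex k φ ih =>
    intro e
    by_cases h : k = i
    · simp [Fm.subst, h]
    · simp only [Fm.subst, h, if_false, sat_ex, ih]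
      refine exists_congr fun x => ?_
      rw [update_comm h, S.val_congr (e := update e k x) (e' := e)]
      intro j hj
      have : j = i := by simpa using ht hj
      exact update_of_ne (by rw [this]; exact fun h' => h h'.symm) _ _

end ArithStr

/-- Renaming of all variables, free and bound. -/
def Tm.rename (ρ : ℕ → ℕ) : Tm → Tm
  | .var k => .var (ρ k)
  | .zero => .zero
  | .succ a => .succ (a.rename ρ)
  | .add a b => .add (a.rename ρ) (b.rename ρ)
  | .mul a b => .mul (a.rename ρ) (b.rename ρ)

/-- Renaming of all variables, free and bound. -/
def Fm.rename (ρ : ℕ → ℕ) : Fm → Fm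
  | .eq a b => .eq (a.rename ρ) (b.rename ρ)
  | .not φ => .not (φ.rename ρ)
  | .and φ ψ => .and (φ.rename ρ) (ψ.rename ρ)
  | .ex i φ => .ex (ρ i) (φ.rename ρ)

theorem Tm.fv_rename (ρ : ℕ → ℕ) (t : Tm) : (t.rename ρ).fv = t.fv.image ρ := by
  induction t with
  | var k => simp [Tm.rename, Tm.fv]
  | zero => rfl
  | succ a ih => exact ih
  | add a b iha ihb | mul a b iha ihb => simp [Tm.rename, Tm.fv, Finset.image_union, iha, ihb]

theorem Fm.fv_rename {ρ : ℕ → ℕ} (hρ : Injective ρ) (φ : Fm) :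
    (φ.rename ρ).fv = φ.fv.image ρ := by
  induction φ with
  | eq a b => simp [Fm.rename, Fm.fv, Tm.fv_rename, Finset.image_union]
  | not φ ih => exact ih
  | and φ ψ ih₁ ih₂ => simp [Fm.rename, Fm.fv, Finset.image_union, ih₁, ih₂]
  | ex i φ ih => simp [Fm.rename, Fm.fv, ih, Finset.image_erase hρ]

/-- Injectivity of `ρ` preserves the side conditions that a bounded variable does not occur in its
bound. -/
theorem IsDelta0.rename {ρ : ℕ → ℕ} (hρ : Injective ρ) {φ : Fm} (h : IsDelta0 φ) :
    IsDelta0 (φ.rename ρ) := by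
  have mem {j : ℕ} {t : Tm} (hj : j ∉ t.fv) : ρ j ∉ (t.rename ρ).fv := by
    rw [Tm.fv_rename]
    intro h
    obtain ⟨k, hk, hkj⟩ := Finset.mem_image.1 h
    exact hj (hρ hkj ▸ hk)
  induction h with
  | eq a b => exact .eq _ _
  | not _ ih => exact .not ih
  | and _ _ ih₁ ih₂ => exact .and ih₁ ih₂
  | le ha hb => exact .le (mem ha) (mem hb)
  | bex hi hj hij _ ih => exact .bex (mem hi) (mem hj) (fun h => hij (hρ h)) ih

namespace ArithStr

variable {M : Type*} (S : ArithStr M)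

theorem val_rename (ρ : ℕ → ℕ) (e : ℕ → M) (t : Tm) :
    S.val e (t.rename ρ) = S.val (e ∘ ρ) t := by
  induction t with
  | var k => rfl
  | zero => rfl
  | succ a ih => simp [Tm.rename, ih]
  | add a b iha ihb | mul a b iha ihb => simp [Tm.rename, iha, ihb]

theorem sat_rename {ρ : ℕ → ℕ} (hρ : Injective ρ) (φ : Fm) : ∀ e : ℕ → M,
    (S.Sat e (φ.rename ρ) ↔ S.Sat (e ∘ ρ) φ) := by
  induction φ with
  | eq a b => intro e; simp [Fm.rename, val_rename]
  | not φ ih => intro e; simp [Fm.rename, ih]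
  | and φ ψ ih₁ ih₂ => intro e; simp [Fm.rename, ih₁, ih₂]
  | ex i φ ih => intro e; simp [Fm.rename, ih, update_comp_eq_of_injective _ hρ]

/-! ### Arithmetic in models of `PA` -/

namespace ModelsPA

variable {S}

theorem succ_ne_zero (h : S.ModelsPA) (x : M) : S.succ x ≠ S.zero := by
  have := h (.all 0 (.not (.eq (.succ (.var 0)) 0))) (.inl (by simp [qAxioms])) (fun _ => x)
  simp at this
  exact this x

theorem succ_inj (h : S.ModelsPA) {x y : M} (hxy : S.succ x = S.succ y) : x = y := by
  have := h (.all 0 (.all 1 (.imp (.eq (.succ (.var 0)) (.succ (.var 1)))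
    (.eq (.var 0) (.var 1))))) (.inl (by simp [qAxioms])) (fun _ => x)
  simp at this
  exact this x y hxy

theorem eq_zero_or_succ (h : S.ModelsPA) (x : M) : x = S.zero ∨ ∃ y, x = S.succ y := by
  have := h (.all 0 (.or (.eq (.var 0) 0) (.ex 1 (.eq (.var 0) (.succ (.var 1))))))
    (.inl (by simp [qAxioms])) (fun _ => x)
  simp at this
  exact this x

theorem add_zero (h : S.ModelsPA) (x : M) : S.add x S.zero = x := by
  have := h (.all 0 (.eq (.var 0 + 0) (.var 0))) (.inl (by simp [qAxioms])) (fun _ => x)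
  simp at this
  exact this x

theorem add_succ (h : S.ModelsPA) (x y : M) : S.add x (S.succ y) = S.succ (S.add x y) := by
  have := h (.all 0 (.all 1 (.eq (.var 0 + .succ (.var 1)) (.succ (.var 0 + .var 1)))))
    (.inl (by simp [qAxioms])) (fun _ => x)
  simp at this
  exact this x y

theorem induction (h : S.ModelsPA) (φ : Fm) (i : ℕ) (e : ℕ → M)
    (h0 : S.Sat (update e i S.zero) φ)
    (hs : ∀ x, S.Sat (update e i x) φ → S.Sat (update e i (S.succ x)) φ) (x : M) :
    S.Sat (update e i x) φ := by
  have := h (inductionAx i φ) (.inr ⟨i, φ, rfl⟩) e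
  have e0 : (0 : Tm).fv ⊆ {i} := by change (∅ : Finset ℕ) ⊆ _; simp
  have es : (Tm.succ (.var i)).fv ⊆ {i} := by simp [Tm.fv]
  simp only [inductionAx, sat_imp, sat_and, sat_all, S.sat_subst e0, S.sat_subst es] at this
  simp at this
  exact this h0 hs x

theorem zero_add (h : S.ModelsPA) (x : M) : S.add S.zero x = x := by
  have := h.induction (.eq (0 + .var 0) (.var 0)) 0 (fun _ => x)
  simp at this
  exact this (h.add_zero _) (fun y hy => by rw [h.add_succ, hy]) x

theorem succ_add (h : S.ModelsPA) (x y : M) : S.add (S.succ x) y = S.succ (S.add x y) := by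
  have := h.induction (.eq (.succ (.var 1) + .var 0) (.succ (.var 1 + .var 0))) 0 (fun _ => x)
  simp at this
  exact this (by rw [h.add_zero, h.add_zero]) (fun y hy => by rw [h.add_succ, hy, h.add_succ]) y

theorem add_comm (h : S.ModelsPA) (x y : M) : S.add x y = S.add y x := by
  have := h.induction (.eq (.var 1 + .var 0) (.var 0 + .var 1)) 0 (fun _ => x)
  simp at this
  exact this (by rw [h.add_zero, h.zero_add])
    (fun y hy => by rw [h.add_succ, hy, h.succ_add]) y

theorem add_assoc (h : S.ModelsPA) (x y z : M) :
    S.add (S.add x y) z = S.add x (S.add y z) := by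
  have := h.induction (.eq ((.var 1 + .var 2) + .var 0) (.var 1 + (.var 2 + .var 0))) 0
    (fun i => if i = 1 then x else y)
  simp at this
  exact this (by rw [h.add_zero, h.add_zero])
    (fun z hz => by rw [h.add_succ, hz, h.add_succ, h.add_succ]) z

end ModelsPA

/-- The order of a structure, `a ≤ b` if `z + a = b` for some `z`. -/
def le (S : ArithStr M) (a b : M) : Prop := ∃ z, S.add z a = b

namespace ModelsPA

variable {S}

theorem zero_le (h : S.ModelsPA) (x : M) : S.le S.zero x := ⟨x, h.add_zero x⟩

theorem le_refl (h : S.ModelsPA) (x : M) : S.le x x := ⟨S.zero, h.zero_add x⟩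

theorem le_trans (h : S.ModelsPA) {x y z : M} : S.le x y → S.le y z → S.le x z := by
  rintro ⟨u, rfl⟩ ⟨v, rfl⟩
  exact ⟨S.add v u, h.add_assoc _ _ _⟩

theorem le_add_left (x y : M) : S.le x (S.add y x) := ⟨y, rfl⟩

theorem le_add_right (h : S.ModelsPA) (x y : M) : S.le x (S.add x y) := ⟨y, h.add_comm _ _⟩

theorem eq_zero_of_le (h : S.ModelsPA) {x : M} : S.le x S.zero → x = S.zero := by
  rintro ⟨z, hz⟩
  rcases h.eq_zero_or_succ x with hx | ⟨y, rfl⟩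
  · exact hx
  · rw [h.add_succ] at hz
    exact absurd hz (h.succ_ne_zero _)

theorem le_succ (h : S.ModelsPA) {x y : M} : S.le x (S.succ y) → S.le x y ∨ x = S.succ y := by
  rintro ⟨z, hz⟩
  rcases h.eq_zero_or_succ z with rfl | ⟨z, rfl⟩
  · rw [h.zero_add] at hz
    exact .inr hz
  · rw [h.succ_add] at hz
    exact .inl ⟨z, h.succ_inj hz⟩

/-- The collection principle. -/
theorem collection (h : S.ModelsPA) (φ : Fm) (n : ℕ) (hφ : ∀ i ∈ φ.fv, i < n + 2) (e : ℕ → M)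
    (t : M) (H : ∀ x, S.le x t → ∃ y, S.Sat (update (update e n x) (n + 1) y) φ) :
    ∃ w, ∀ x, S.le x t → ∃ y, S.le y w ∧ S.Sat (update (update e n x) (n + 1) y) φ := by
  -- Only `x_i` with `i < n + 2` are free in `φ`, so the indices `n + 2`, `n + 3`, `n + 4` can carry
  -- the induction variable `u`, the bound `w` and the parameter `t`.
  have agree (u w x y : M) :
      S.Sat (update (update (update (update (update e (n + 4) t) (n + 2) u) (n + 3) w) n x)
        (n + 1) y) φ ↔ S.Sat (update (update e n x) (n + 1) y) φ :=
    S.sat_congr fun i hi => by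
      have := hφ i hi
      rcases (by omega : i = n + 1 ∨ i = n ∨ i < n) with rfl | rfl | h
      · simp
      · simp
      · simp only [update_apply]
        repeat rw [if_neg (by omega)]
  -- Induction on `u` for the formula `∃ w ∀ x ≤ u (x ≤ t → ∃ y ≤ w φ)`; the variable `x_{n+5}` only
  -- serves to express the order.
  have ind := h.induction
    (.ex (n + 3) (.not (.ex n (.and (.ex (n + 5) (.eq (.var (n + 5) + .var n) (.var (n + 2))))
      (.and (.ex (n + 5) (.eq (.var (n + 5) + .var n) (.var (n + 4))))
      (.not (.ex (n + 1) (.and (.ex (n + 5) (.eq (.var (n + 5) + .var (n + 1)) (.var (n + 3))))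
        φ))))))))
    (n + 2) (update e (n + 4) t)
  have key : (∃ w, ∀ x, S.le x S.zero → S.le x t → ∃ y, S.le y w ∧
      S.Sat (update (update e n x) (n + 1) y) φ) →
      (∀ u w, (∀ x, S.le x u → S.le x t → ∃ y, S.le y w ∧
        S.Sat (update (update e n x) (n + 1) y) φ) →
        ∃ w, ∀ x, S.le x (S.succ u) → S.le x t → ∃ y, S.le y w ∧
          S.Sat (update (update e n x) (n + 1) y) φ) →
      ∀ u, ∃ w, ∀ x, S.le x u → S.le x t → ∃ y, S.le y w ∧
        S.Sat (update (update e n x) (n + 1) y) φ := by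
    simpa [agree, le] using ind
  have ⟨w, hw⟩ := key ?_ ?_ t
  · exact ⟨w, fun x hx => hw x hx hx⟩
  · obtain ⟨y, hy⟩ := H S.zero (h.zero_le t)
    refine ⟨y, fun x hx _ => ⟨y, h.le_refl y, ?_⟩⟩
    rwa [h.eq_zero_of_le hx]
  · intro u w hw
    by_cases hu : S.le (S.succ u) t
    · obtain ⟨y₀, hy₀⟩ := H _ hu
      -- The sum exceeds both the old bound and the witness for the new point `S(u)`.
      refine ⟨S.add w y₀, fun x hx hxt => ?_⟩
      rcases h.le_succ hx with hx | rfl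
      · obtain ⟨y, hy, hy'⟩ := hw x hx hxt
        exact ⟨y, h.le_trans hy (h.le_add_right _ _), hy'⟩
      · exact ⟨y₀, le_add_left _ _, hy₀⟩
    · refine ⟨w, fun x hx hxt => ?_⟩
      rcases h.le_succ hx with hx | rfl
      · exact hw x hx hxt
      · exact absurd hxt hu

end ModelsPA

end ArithStr

/-- Equivalences in the hierarchy are stated for models of PA; this is what allows them to be read
in ℕ. -/
theorem stdN_modelsPA : stdN.ModelsPA := by
  rintro φ (h | ⟨i, ψ, rfl⟩) e
  · simp only [qAxioms, List.mem_cons, List.not_mem_nil, or_false] at h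
    rcases h with rfl | rfl | rfl | rfl | rfl | rfl | rfl
    · simp [stdN]
    · simp [stdN]
    · simp only [ArithStr.sat_all, ArithStr.sat_or, ArithStr.sat_eq, ArithStr.sat_ex]
      intro x
      cases x <;> simp [stdN]
    · simp [stdN]
    · simp [stdN, Nat.add_assoc]
    · simp [stdN]
    · simp [stdN, Nat.mul_succ]
  · have e0 : (0 : Tm).fv ⊆ {i} := by change (∅ : Finset ℕ) ⊆ _; simp
    have es : (Tm.succ (.var i)).fv ⊆ {i} := by simp [Tm.fv]
    simp only [inductionAx, ArithStr.sat_imp, ArithStr.sat_and, ArithStr.sat_all,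
      stdN.sat_subst e0, stdN.sat_subst es]
    rintro ⟨h0, hs⟩ x
    induction x with
    | zero => exact h0
    | succ x ih => simpa [stdN] using hs x ih

/-! ### Levels of the arithmetical hierarchy up to equivalence in `PA` -/

/-- Relations on environments, uniformly given in all structures. -/
abbrev URel : Type 1 := ∀ (M : Type), ArithStr M → (ℕ → M) → Prop

/-- Equivalence of two relations in all models of `PA`. -/
def URel.Equiv (R Q : URel) : Prop :=
  ∀ (M : Type) (S : ArithStr M), S.ModelsPA → ∀ e, (R M S e ↔ Q M S e)

/-- The relation defined by a formula. -/
def Fm.rel (φ : Fm) : URel := fun _ S e => S.Sat e φ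

/-- `R` is, in all models of `PA`, definable by a `Δ₀` formula for `k = 0`, or by `k` single
alternating quantifiers, the first one existential, followed by a `Δ₀` formula. Only the
variables `x_i` with `i < n` occur free. -/
def Sg : ℕ → ℕ → URel → Prop
  | 0, n, R => ∃ θ : Fm, IsDelta0 θ ∧ (∀ i ∈ θ.fv, i < n) ∧ R.Equiv θ.rel
  | k + 1, n, R => ∃ T : URel, Sg k (n + 1) T ∧
      R.Equiv fun M S e => ∃ x, ¬ T M S (update e n x)

namespace Sg

variable {k n : ℕ} {R Q : URel}

theorem congr (h : R.Equiv Q) (hR : Sg k n R) : Sg k n Q := by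
  cases k with
  | zero =>
    obtain ⟨θ, h₁, h₂, h₃⟩ := hR
    exact ⟨θ, h₁, h₂, fun M S hS e => (h M S hS e).symm.trans (h₃ M S hS e)⟩
  | succ k =>
    obtain ⟨T, h₁, h₂⟩ := hR
    exact ⟨T, h₁, fun M S hS e => (h M S hS e).symm.trans (h₂ M S hS e)⟩

/-- The Σ form of the relation and the Π form of its negation are produced together, because each
further quantifier exchanges the two. -/
theorem exists_formula (h : Sg k n R) :
    (∃ ψ : Fm, IsSigma k ψ ∧ (∀ i ∈ ψ.fv, i < n) ∧ R.Equiv ψ.rel) ∧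
    ∃ π : Fm, IsPi k π ∧ (∀ i ∈ π.fv, i < n) ∧ URel.Equiv (fun M S e => ¬ R M S e) π.rel := by
  induction k generalizing n R with
  | zero =>
    obtain ⟨θ, h₁, h₂, h₃⟩ := h
    refine ⟨⟨θ, .zero h₁, h₂, h₃⟩, .not θ, .zero (.not h₁), h₂, fun M S hS e => ?_⟩
    simp [Fm.rel, h₃ M S hS e]
  | succ k ih =>
    obtain ⟨T, h₁, h₂⟩ := h
    obtain ⟨⟨ψ, hψ, hψn, hTψ⟩, π, hπ, hπn, hTπ⟩ := ih h₁
    constructor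
    · refine ⟨.ex n π, .ex n (.ofPi hπ), fun i hi => ?_, fun M S hS e => ?_⟩
      · obtain ⟨h, h'⟩ := Finset.mem_erase.1 hi
        have := hπn i h'
        omega
      · rw [h₂ M S hS e]
        simp only [Fm.rel, ArithStr.sat_ex]
        exact exists_congr fun x => hTπ M S hS _
    · refine ⟨.all n ψ, .all n (.ofSigma hψ), fun i hi => ?_, fun M S hS e => ?_⟩
      · obtain ⟨h, h'⟩ := Finset.mem_erase.1 hi
        have := hψn i h'
        omega
      · simp only [h₂ M S hS e, Fm.rel, ArithStr.sat_all, not_exists, not_not]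
        exact forall_congr' fun x => hTψ M S hS _

/-- For `k > 0` the definition of `Sg` speaks of relations rather than formulas, so dependence on
the first `n` variables alone is recovered from a defining formula. -/
theorem local_iff (h : Sg k n R) {M : Type} {S : ArithStr M} (hS : S.ModelsPA) {e e' : ℕ → M}
    (he : ∀ i < n, e i = e' i) : R M S e ↔ R M S e' := by
  obtain ⟨⟨ψ, -, hψn, hψ⟩, -⟩ := h.exists_formula
  rw [hψ M S hS, hψ M S hS]
  exact S.sat_congr fun i hi => he i (hψn i hi)

theorem rename {m : ℕ} {ρ : ℕ → ℕ} (hρ : Injective ρ) (hlt : ∀ i < n, ρ i < m) (h : Sg k n R) :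
    Sg k m fun M S e => R M S (e ∘ ρ) := by
  induction k generalizing n m R ρ with
  | zero =>
    obtain ⟨θ, h₁, h₂, h₃⟩ := h
    refine ⟨θ.rename ρ, h₁.rename hρ, fun i hi => ?_, fun M S hS e => ?_⟩
    · rw [Fm.fv_rename hρ] at hi
      obtain ⟨j, hj, rfl⟩ := Finset.mem_image.1 hi
      exact hlt j (h₂ j hj)
    · simp only [h₃ M S hS]
      exact (S.sat_rename hρ θ e).symm
  | succ k ih =>
    obtain ⟨T, h₁, h₂⟩ := h
    -- The quantified variable `x_n` has to become `x_m`. Sending all indices from `n` on to indices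
    -- from `m` on keeps the map injective, since `ρ` takes values below `m` on indices below `n`.
    let σ : ℕ → ℕ := fun i => if i < n then ρ i else m + (i - n)
    have hσ : Injective σ := by
      intro i j hij
      simp only [σ] at hij
      split_ifs at hij with hi hj hj
      · exact hρ hij
      · have := hlt i hi; omega
      · have := hlt j hj; omega
      · omega
    refine ⟨_, ih (m := m + 1) hσ (fun i hi => ?_) h₁, fun M S hS e => ?_⟩
    · simp only [σ]
      split_ifs with h'
      · have := hlt i h'; omega
      · omega
    · simp only [h₂ M S hS]
      refine exists_congr fun x => not_congr (h₁.local_iff hS fun i hi => ?_)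
      by_cases h' : i = n
      · simp [σ, h']
      · have hin : i < n := by omega
        have := hlt i hin
        simp only [comp_apply, σ, if_pos hin, update_of_ne h']
        rw [update_of_ne (by omega)]

theorem mono {m : ℕ} (h : Sg k n R) (hnm : n ≤ m) : Sg k m R :=
  h.rename (ρ := id) injective_id fun _ hi => lt_of_lt_of_le hi hnm

/-- A dummy existential quantifier in front of the double negation of `R`. -/
theorem of_not (h : Sg k n fun M S e => ¬ R M S e) : Sg (k + 1) n R := by
  refine ⟨_, h.mono (Nat.le_succ n), fun M S hS e => ?_⟩
  have (x : M) : R M S (update e n x) ↔ R M S e :=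
    not_iff_not.1 (h.local_iff hS fun i _ => update_of_ne (by omega) _ _)
  exact ⟨fun hR => ⟨S.zero, not_not.2 ((this _).2 hR)⟩,
    fun ⟨x, hx⟩ => (this x).1 (not_not.1 hx)⟩

theorem succ (h : Sg k n R) : Sg (k + 1) n R := by
  induction k generalizing n R with
  | zero =>
    obtain ⟨θ, h₁, h₂, h₃⟩ := h
    refine of_not ⟨.not θ, .not h₁, h₂, fun M S hS e => ?_⟩
    simp [Fm.rel, h₃ M S hS e]
  | succ k ih =>
    obtain ⟨T, h₁, h₂⟩ := h
    exact ⟨T, ih h₁, h₂⟩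

theorem not_succ (h : Sg k n R) : Sg (k + 1) n fun M S e => ¬ R M S e :=
  of_not (h.congr fun _ _ _ _ => not_not.symm)

theorem le {t u : Tm} (ht : t.bd ≤ n) (hu : u.bd ≤ n) :
    Sg 0 n fun _ S e => S.le (S.val e t) (S.val e u) := by
  have hn {t : Tm} (ht : t.bd ≤ n) : n ∉ t.fv := fun h => by have := Tm.lt_bd h; omega
  refine ⟨.ex n (.eq (.var n + t) u), .le (hn ht) (hn hu), fun i hi => ?_, fun M S hS e => ?_⟩
  · obtain ⟨h, h'⟩ := Finset.mem_erase.1 hi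
    simp only [Fm.fv, Tm.fv, Finset.mem_union, Finset.mem_singleton] at h'
    rcases h' with (h' | h') | h'
    · exact absurd h' h
    · exact (Tm.lt_bd h').trans_le ht
    · exact (Tm.lt_bd h').trans_le hu
  · simp [Fm.rel, ArithStr.le, S.val_update_of_bd ht, S.val_update_of_bd hu]

/-- Closure of a level of the hierarchy under positive connectives and bounded quantifiers. -/
structure Closed (k : ℕ) : Prop where
  and {n : ℕ} {R Q : URel} : Sg k n R → Sg k n Q → Sg k n fun M S e => R M S e ∧ Q M S e
  or {n : ℕ} {R Q : URel} : Sg k n R → Sg k n Q → Sg k n fun M S e => R M S e ∨ Q M S e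
  bex {n : ℕ} {R : URel} {t : Tm} : t.bd ≤ n → Sg k (n + 1) R →
    Sg k n fun M S e => ∃ x, S.le x (S.val e t) ∧ R M S (update e n x)
  ball {n : ℕ} {R : URel} {t : Tm} : t.bd ≤ n → Sg k (n + 1) R →
    Sg k n fun M S e => ∀ x, S.le x (S.val e t) → R M S (update e n x)

theorem not_zero (h : Sg 0 n R) : Sg 0 n fun M S e => ¬ R M S e := by
  obtain ⟨θ, h₁, h₂, h₃⟩ := h
  exact ⟨.not θ, .not h₁, h₂, fun M S hS e => by simp [Fm.rel, h₃ M S hS e]⟩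

theorem closed_zero : Closed 0 := by
  have hand {n : ℕ} {R Q : URel} (hR : Sg 0 n R) (hQ : Sg 0 n Q) :
      Sg 0 n fun M S e => R M S e ∧ Q M S e := by
    obtain ⟨θ, h₁, h₂, h₃⟩ := hR
    obtain ⟨η, h₁', h₂', h₃'⟩ := hQ
    refine ⟨.and θ η, .and h₁ h₁', fun i hi => ?_, fun M S hS e => ?_⟩
    · simp only [Fm.fv, Finset.mem_union] at hi
      exact hi.elim (h₂ i) (h₂' i)
    · simp [Fm.rel, h₃ M S hS e, h₃' M S hS e]
  have hbex {n : ℕ} {R : URel} {t : Tm} (ht : t.bd ≤ n) (hR : Sg 0 (n + 1) R) :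
      Sg 0 n fun M S e => ∃ x, S.le x (S.val e t) ∧ R M S (update e n x) := by
    obtain ⟨θ, h₁, h₂, h₃⟩ := hR
    -- Both the bounded variable `x_n` and the variable `x_{n+1}` expressing the order must be
    -- absent from the bound.
    have hn {j : ℕ} (hj : n ≤ j) : j ∉ t.fv := fun h => by have := Tm.lt_bd h; omega
    refine ⟨.ex n (.and (.ex (n + 1) (.eq (.var (n + 1) + .var n) t)) θ),
      .bex (hn le_rfl) (hn (Nat.le_succ n)) (by omega) h₁, fun i hi => ?_, fun M S hS e => ?_⟩
    · simp only [Fm.fv, HAdd.hAdd, Add.add, Tm.fv, Finset.mem_union, Finset.mem_singleton,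
        Finset.mem_erase] at hi
      rcases hi with ⟨h, ⟨h', (hi | hi) | hi⟩ | hi⟩
      · exact absurd hi h'
      · exact absurd hi h
      · exact (Tm.lt_bd hi).trans_le ht
      · have := h₂ i hi
        omega
    · simp [Fm.rel, ArithStr.le, S.val_update_of_bd ht,
        S.val_update_of_bd (ht.trans (Nat.le_succ n)), h₃ M S hS]
  exact {
    and := hand
    or := fun hR hQ => (hand hR.not_zero hQ.not_zero).not_zero.congr fun M S _ e => by tauto
    bex := hbex
    ball := fun ht hR => (hbex ht hR.not_zero).not_zero.congr fun M S _ e => by simp }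

/-- Contraction of two quantifiers. -/
theorem contract (hk : Closed k) (h : Sg k (n + 2) Q)
    (hR : R.Equiv fun M S e => ∃ x y, ¬ Q M S (update (update e n x) (n + 1) y)) :
    Sg (k + 1) n R := by
  -- Shifts the two quantified variables up by one, freeing index `n` for their common bound.
  let ρ : ℕ → ℕ := fun i => if i < n then i else i + 1
  have hρ : Injective ρ := by
    intro i j hij
    simp only [ρ] at hij
    split_ifs at hij <;> omega
  have h' := h.rename (m := n + 3) hρ fun i hi => by simp only [ρ]; split_ifs <;> omega
  have hb {m : ℕ} (hm : n + 1 ≤ m) : (Tm.var n).bd ≤ m := hm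
  -- The matrix is `∀ x ≤ w ∀ y ≤ w Q`, which stays in level `k`; its negation after `∃ w` says that
  -- a counterexample to `Q` exists below some bound.
  refine ⟨_, hk.ball (hb le_rfl) (hk.ball (hb (Nat.le_succ _)) h'), fun M S hS e => ?_⟩
  have agree (w x y : M) : Q M S (update (update (update e n w) (n + 1) x) (n + 1 + 1) y ∘ ρ) ↔
      Q M S (update (update e n x) (n + 1) y) := by
    refine h.local_iff hS fun i hi => ?_
    rcases (by omega : i = n + 1 ∨ i = n ∨ i < n) with rfl | rfl | h
    · simp [ρ]
    · simp [ρ]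
    · simp only [comp_apply, ρ, if_pos h, update_apply]
      repeat rw [if_neg (by omega)]
  rw [hR M S hS]
  simp only [agree, not_forall]
  constructor
  · rintro ⟨x, y, h⟩
    refine ⟨S.add x y, x, ?_, y, ?_, h⟩
    · simpa using hS.le_add_right x y
    · simpa using ArithStr.ModelsPA.le_add_left y x
  · rintro ⟨w, x, -, y, -, h⟩
    exact ⟨x, y, h⟩

theorem ex_of_closed (hk : Closed k) (hR : Sg (k + 1) (n + 1) R) :
    Sg (k + 1) n fun M S e => ∃ x, R M S (update e n x) := by
  obtain ⟨T, h₁, h₂⟩ := hR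
  exact contract hk h₁ fun M S hS e => exists_congr fun x => h₂ M S hS _

/-- Conjunction merges two existential quantifiers into a pair and contracts it. Disjunction shares
one existential quantifier. A bounded existential quantifier is an ordinary one with the order as an
extra conjunct. The bounded universal quantifier is the case that needs collection. -/
theorem closed_succ (hk : Closed k) : Closed (k + 1) := by
  have hand {n : ℕ} {R Q : URel} (hR : Sg (k + 1) n R) (hQ : Sg (k + 1) n Q) :
      Sg (k + 1) n fun M S e => R M S e ∧ Q M S e := by
    obtain ⟨T, h₁, h₂⟩ := hR
    obtain ⟨T', h₁', h₂'⟩ := hQ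
    let ρ : ℕ → ℕ := fun i => if i < n then i else i + 1
    have hρ : Injective ρ := by
      intro i j hij
      simp only [ρ] at hij
      split_ifs at hij <;> omega
    have h' := h₁'.rename (m := n + 2) hρ fun i hi => by simp only [ρ]; split_ifs <;> omega
    refine contract hk (hk.or (h₁.mono (Nat.le_succ _)) h') fun M S hS e => ?_
    have agree (x y : M) : T M S (update (update e n x) (n + 1) y) ↔ T M S (update e n x) :=
      h₁.local_iff hS fun i hi => update_of_ne (by omega) _ _
    have agree' (x y : M) : T' M S (update (update e n x) (n + 1) y ∘ ρ) ↔
        T' M S (update e n y) := by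
      refine h₁'.local_iff hS fun i hi => ?_
      rcases (by omega : i = n ∨ i < n) with rfl | h
      · simp [ρ]
      · simp only [comp_apply, ρ, if_pos h, update_apply]
        repeat rw [if_neg (by omega)]
    simp [h₂ M S hS, h₂' M S hS, agree, agree']
  have hle {n : ℕ} {t : Tm} (ht : t.bd ≤ n) :
      Sg (k + 1) (n + 1) fun _ S e => S.le (e n) (S.val e t) := by
    have h := le (t := .var n) (n := n + 1) le_rfl (ht.trans (Nat.le_succ n))
    have : ∀ j, Sg j (n + 1) fun _ S e => S.le (e n) (S.val e t) := fun j => by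
      induction j with
      | zero => exact h
      | succ j ih => exact ih.succ
    exact this _
  refine ⟨hand, ?_, ?_, ?_⟩
  · rintro n R Q ⟨T, h₁, h₂⟩ ⟨T', h₁', h₂'⟩
    refine ⟨_, hk.and h₁ h₁', fun M S hS e => ?_⟩
    simp only [h₂ M S hS, h₂' M S hS, ← exists_or]
    exact exists_congr fun x => by tauto
  · intro n R t ht hR
    refine (ex_of_closed hk (hand (hle ht) hR)).congr fun M S hS e => exists_congr fun x => ?_
    simp [S.val_update_of_bd ht]
  · rintro n R t ht ⟨T, h₁, h₂⟩
    let ρ : ℕ → ℕ := fun i => if i < n then i else i + 1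
    have hρ : Injective ρ := by
      intro i j hij
      simp only [ρ] at hij
      split_ifs at hij <;> omega
    have h' := h₁.rename (m := n + 3) hρ fun i hi => by simp only [ρ]; split_ifs <;> omega
    -- By collection, `∀ x ≤ t ∃ y ¬T` is equivalent to `∃ w ∀ x ≤ t ∃ y ≤ w ¬T`. The negated matrix
    -- `∃ x ≤ t ∀ y ≤ w T` lies in level `k` by the closure hypothesis.
    refine ⟨_, hk.bex (n := n + 1) (t := t) (by omega)
      (hk.ball (n := n + 2) (t := .var n) (by simp) h'), fun M S hS e => ?_⟩
    have agree (w x y : M) :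
        T M S (update (update (update e n w) (n + 1) x) (n + 1 + 1) y ∘ ρ) ↔
          T M S (update (update e n x) (n + 1) y) := by
      refine h₁.local_iff hS fun i hi => ?_
      rcases (by omega : i = n + 1 ∨ i = n ∨ i < n) with rfl | rfl | h
      · simp [ρ]
      · simp [ρ]
      · simp only [comp_apply, ρ, if_pos h, update_apply]
        repeat rw [if_neg (by omega)]
    -- Collection is available for formulas only, so `¬T` is replaced by a formula defining it in
    -- all models of PA.
    obtain ⟨⟨ψ, -, hψn, hψ⟩, -⟩ := h₁.not_succ.exists_formula
    have coll := hS.collection ψ n hψn e (S.val e t)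
    simp only [URel.Equiv, Fm.rel] at hψ
    simp only [← hψ M S hS] at coll
    simp [h₂ M S hS, agree, S.val_update_of_bd ht]
    constructor
    · intro h
      obtain ⟨w, hw⟩ := coll h
      exact ⟨w, fun x hx => hw x hx⟩
    · rintro ⟨w, hw⟩ x hx
      obtain ⟨y, -, hy⟩ := hw x hx
      exact ⟨y, hy⟩

theorem closed (k : ℕ) : Closed k := by
  induction k with
  | zero => exact closed_zero
  | succ k ih => exact closed_succ ih

theorem ex (hR : Sg (k + 1) (n + 1) R) : Sg (k + 1) n fun M S e => ∃ x, R M S (update e n x) :=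
  ex_of_closed (closed k) hR

end Sg

end ArithModels

namespace ArithModels

open Function

/-! ### Complexity of formulas given by builders -/

/-- All variables of `t` have index below `n`. -/
class Tm.Below (t : Tm) (n : ℕ) : Prop where
  bd_le : t.bd ≤ n

namespace Tm.Below

instance var_succ (n : ℕ) : Below (.var n) (n + 1) := ⟨le_rfl⟩
instance of_succ (t : Tm) (n : ℕ) [h : Below t n] : Below t (n + 1) := ⟨h.1.trans (Nat.le_succ n)⟩
instance zero (n : ℕ) : Below 0 n := ⟨Nat.zero_le n⟩
instance num (k n : ℕ) : Below (.num k) n := ⟨by simp⟩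
instance succ (t : Tm) (n : ℕ) [h : Below t n] : Below t.succ n := ⟨h.1⟩
instance add (t u : Tm) (n : ℕ) [h : Below t n] [h' : Below u n] : Below (t + u) n :=
  ⟨max_le h.1 h'.1⟩
instance mul (t u : Tm) (n : ℕ) [h : Below t n] [h' : Below u n] : Below (t * u) n :=
  ⟨max_le h.1 h'.1⟩
instance prT (t u : Tm) (n : ℕ) [Below t n] [Below u n] : Below (prT t u) n := by
  unfold ArithModels.prT; infer_instance
instance cVar (t : Tm) (n : ℕ) [Below t n] : Below (cVar t) n := by
  unfold ArithModels.cVar; infer_instance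
instance cZero (n : ℕ) : Below cZero n := by
  unfold ArithModels.cZero; infer_instance
instance cSucc (t : Tm) (n : ℕ) [Below t n] : Below (cSucc t) n := by
  unfold ArithModels.cSucc; infer_instance
instance cAdd (t u : Tm) (n : ℕ) [Below t n] [Below u n] : Below (cAdd t u) n := by
  unfold ArithModels.cAdd; infer_instance
instance cMul (t u : Tm) (n : ℕ) [Below t n] [Below u n] : Below (cMul t u) n := by
  unfold ArithModels.cMul; infer_instance
instance cEq (t u : Tm) (n : ℕ) [Below t n] [Below u n] : Below (cEq t u) n := by
  unfold ArithModels.cEq; infer_instance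
instance cNot (t : Tm) (n : ℕ) [Below t n] : Below (cNot t) n := by
  unfold ArithModels.cNot; infer_instance
instance cAnd (t u : Tm) (n : ℕ) [Below t n] [Below u n] : Below (cAnd t u) n := by
  unfold ArithModels.cAnd; infer_instance
instance cEx (t u : Tm) (n : ℕ) [Below t n] [Below u n] : Below (cEx t u) n := by
  unfold ArithModels.cEx; infer_instance
instance cImp (t u : Tm) (n : ℕ) [Below t n] [Below u n] : Below (cImp t u) n := by
  unfold ArithModels.cImp; infer_instance
instance cAll (t u : Tm) (n : ℕ) [Below t n] [Below u n] : Below (cAll t u) n := by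
  unfold ArithModels.cAll; infer_instance
instance cLe (j t u : Tm) (n : ℕ) [Below j n] [Below t n] [Below u n] : Below (cLe j t u) n := by
  unfold ArithModels.cLe; infer_instance
instance cBex (i j t u : Tm) (n : ℕ) [Below i n] [Below j n] [Below t n] [Below u n] :
    Below (cBex i j t u) n := by
  unfold ArithModels.cBex; infer_instance
instance quoteT (t : Tm) (n : ℕ) : Below (quoteT t) n := by
  induction t <;> (unfold ArithModels.quoteT; infer_instance)
instance quoteF (φ : Fm) (n : ℕ) : Below (quoteF φ) n := by
  induction φ <;> (unfold ArithModels.quoteF; infer_instance)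

theorem lt {t : Tm} {n : ℕ} (h : Below t n) {i : ℕ} (hi : i ∈ t.fv) : i < n :=
  (Tm.lt_bd hi).trans_le h.1

end Tm.Below

open Tm (Below)

/-- The formula has free variables `x_i` with `i < n` only, and is in level `k` of the
hierarchy `Sg`. -/
class IsSg (k n : ℕ) (φ : Fm) : Prop where
  lt : ∀ i ∈ φ.fv, i < n
  sg : Sg k n φ.rel

theorem Sg.of_zero {n : ℕ} {R : URel} (h : Sg 0 n R) (k : ℕ) : Sg k n R := by
  induction k with
  | zero => exact h
  | succ k ih => exact ih.succ

namespace IsSg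

variable {k n : ℕ} {f g : Bd}

theorem succ {φ : Fm} (h : IsSg k n φ) : IsSg (k + 1) n φ := ⟨h.lt, h.sg.succ⟩

theorem not_succ {φ : Fm} (h : IsSg k n φ) : IsSg (k + 1) n (.not φ) :=
  ⟨h.lt, h.sg.not_succ.congr fun _ S _ e => (S.sat_not e φ).symm⟩

/-- The instances on builders let typeclass search compute levels by following the construction of a
formula. Negations and antecedents of implications are handled automatically only at level 0, since
higher levels are not closed under negation. -/
instance eqB (a b : Tm) [ha : Below a n] [hb : Below b n] : IsSg k n (eqB a b n) := by
  have h : ∀ i ∈ (Fm.eq a b).fv, i < n := fun i hi =>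
    (Finset.mem_union.1 hi).elim ha.lt hb.lt
  exact ⟨h, Sg.of_zero ⟨_, .eq a b, h, fun _ _ _ _ => Iff.rfl⟩ k⟩

instance notB [h : IsSg 0 n (f n)] : IsSg k n (notB f n) :=
  ⟨h.lt, (h.sg.not_zero.congr fun _ S _ e => (S.sat_not e (f n)).symm).of_zero k⟩

instance andB [hf : IsSg k n (f n)] [hg : IsSg k n (g n)] : IsSg k n (andB f g n) :=
  ⟨fun i hi => (Finset.mem_union.1 hi).elim (hf.lt i) (hg.lt i),
    ((Sg.closed k).and hf.sg hg.sg).congr fun _ S _ e => (S.sat_and e (f n) (g n)).symm⟩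

instance orB [hf : IsSg k n (f n)] [hg : IsSg k n (g n)] : IsSg k n (orB f g n) :=
  ⟨fun i hi => (Finset.mem_union.1 hi).elim (hf.lt i) (hg.lt i),
    ((Sg.closed k).or hf.sg hg.sg).congr fun _ S _ e => (S.sat_or e (f n) (g n)).symm⟩

/-- Being Π is expressed as the negation lying in a level of `Sg`; the lemmas named `not_…` are the
closure rules for Π formulas in this form. -/
theorem not_andB (hf : IsSg k n (.not (f n))) (hg : IsSg k n (.not (g n))) :
    IsSg k n (.not (ArithModels.andB f g n)) :=
  ⟨fun i hi => (Finset.mem_union.1 hi).elim (hf.lt i) (hg.lt i),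
    ((Sg.closed k).or hf.sg hg.sg).congr fun _ S _ e => by
      simp [ArithModels.andB, Fm.rel]; tauto⟩

theorem impB' (hf : IsSg k n (.not (f n))) (hg : IsSg k n (g n)) :
    IsSg k n (ArithModels.impB f g n) :=
  ⟨fun i hi => (Finset.mem_union.1 hi).elim (hf.lt i) (hg.lt i),
    ((Sg.closed k).or hf.sg hg.sg).congr fun _ S _ e => by
      simp [ArithModels.impB, Fm.rel]; tauto⟩

instance impB [hf : IsSg 0 n (f n)] [hg : IsSg k n (g n)] : IsSg k n (impB f g n) :=
  impB' (IsSg.notB (f := f)) hg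

theorem not_impB (hf : IsSg k n (f n)) (hg : IsSg k n (.not (g n))) :
    IsSg k n (.not (ArithModels.impB f g n)) :=
  ⟨fun i hi => (Finset.mem_union.1 hi).elim (hf.lt i) (hg.lt i),
    ((Sg.closed k).and hf.sg hg.sg).congr fun _ S _ e => by
      simp [ArithModels.impB, Fm.rel]⟩

theorem not_notB (hf : IsSg k n (f n)) : IsSg k n (.not (ArithModels.notB f n)) :=
  ⟨hf.lt, hf.sg.congr fun _ S _ e => by simp [ArithModels.notB, Fm.rel]⟩

theorem lt_ex {φ : Fm} (h : ∀ i ∈ φ.fv, i < n + 1) : ∀ i ∈ (Fm.ex n φ).fv, i < n := by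
  intro i hi
  obtain ⟨h₁, h₂⟩ := Finset.mem_erase.1 hi
  have := h i h₂
  omega

variable {F : Tm → Bd}

instance exB [h : IsSg (k + 1) (n + 1) (F (.var n) (n + 1))] : IsSg (k + 1) n (exB F n) :=
  ⟨lt_ex h.lt, h.sg.ex.congr fun _ S _ e => (S.sat_ex e n _).symm⟩

theorem not_allB (h : IsSg (k + 1) (n + 1) (.not (F (.var n) (n + 1)))) :
    IsSg (k + 1) n (.not (ArithModels.allB F n)) :=
  ⟨lt_ex h.lt, h.sg.ex.congr fun _ S _ e => by
    simp [ArithModels.allB, Fm.rel]⟩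

theorem lt_leB {a b : Tm} [ha : Below a n] [hb : Below b n] :
    ∀ i ∈ (ArithModels.leB a b n).fv, i < n := by
  have : IsSg 0 (n + 1) (ArithModels.eqB (.var n + a) b (n + 1)) := inferInstance
  exact lt_ex this.lt

theorem _root_.ArithModels.ArithStr.sat_leB {M : Type*} (S : ArithStr M) (e : ℕ → M) {a b : Tm}
    [ha : Below a n] [hb : Below b n] :
    S.Sat e (leB a b n) ↔ S.le (S.val e a) (S.val e b) := by
  simp [leB, ArithModels.exB, ArithModels.eqB, ArithStr.le, S.val_update_of_bd ha.1,
    S.val_update_of_bd hb.1]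

instance leB (a b : Tm) [ha : Below a n] [hb : Below b n] : IsSg k n (leB a b n) :=
  ⟨lt_leB, ((Sg.le ha.1 hb.1).congr fun _ S _ e => S.sat_leB e |>.symm).of_zero k⟩

instance ltB (a b : Tm) [ha : Below a n] [hb : Below b n] : IsSg k n (ltB a b n) := by
  unfold ArithModels.ltB; infer_instance

instance bexB (t : Tm) [ht : Below t n] [h : IsSg k (n + 1) (F (.var n) (n + 1))] :
    IsSg k n (bexB t F n) := by
  refine ⟨lt_ex fun i hi => (Finset.mem_union.1 hi).elim (lt_leB i) (h.lt i),
    ((Sg.closed k).bex ht.1 h.sg).congr fun _ S _ e => ?_⟩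
  simp [ArithModels.bexB, Fm.rel, ArithModels.exB, ArithModels.andB, S.sat_leB,
    S.val_update_of_bd ht.1]

instance ballB (t : Tm) [ht : Below t n] [h : IsSg k (n + 1) (F (.var n) (n + 1))] :
    IsSg k n (ballB t F n) := by
  refine ⟨lt_ex fun i hi => (Finset.mem_union.1 hi).elim (lt_leB i) (h.lt i),
    ((Sg.closed k).ball ht.1 h.sg).congr fun _ S _ e => ?_⟩
  simp [ArithModels.ballB, ArithModels.notB, ArithModels.bexB, Fm.rel, ArithModels.exB,
    ArithModels.andB, S.sat_leB, S.val_update_of_bd ht.1]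

instance betaB (c d i v : Tm) [Below c n] [Below d n] [Below i n] [Below v n] :
    IsSg k n (betaB c d i v n) := by
  unfold ArithModels.betaB; infer_instance

end IsSg

/-- The formula `prev` in the scope of the first four quantifiers of `derivB`. -/
def prevB (n : ℕ) (z : Tm) : Bd :=
  bexB (.var (n + 3)) fun j => ltB j (.var (n + 3)) ⩓ betaB (.var n) (.var (n + 1)) j z

namespace IsSg

variable {k n : ℕ}

instance prevB (m : ℕ) (z : Tm) [Below z m] [h : Below (.var (n + 3)) m] :
    IsSg k m (prevB n z m) := by
  have := h.1
  have h₀ : Below (.var n) m := ⟨by simp at this ⊢; omega⟩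
  have h₁ : Below (.var (n + 1)) m := ⟨by simp at this ⊢; omega⟩
  unfold ArithModels.prevB; infer_instance

/-- A derivation is a block of existential quantifiers, a bounded universal one, an existential one
and then the step, so its level is that of the step, provided it is at least 1. The step lives below
five bound variables: the two β parameters, the length, the position and the entry. -/
instance derivB (step : (Tm → Bd) → Tm → Bd) (x : Tm) [Below x n]
    [h : IsSg (k + 1) (n + 5) (step (ArithModels.prevB n) (.var (n + 4)) (n + 5))] :
    IsSg (k + 1) n (derivB step x n) := by
  have : IsSg (k + 1) (n + 5) (step (fun z => ArithModels.bexB (.var (n + 3)) fun j =>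
      ArithModels.ltB j (.var (n + 3)) ⩓ ArithModels.betaB (.var n) (.var (n + 1)) j z)
      (.var (n + 4)) (n + 5)) := h
  unfold ArithModels.derivB; infer_instance

instance dvdB (p u : Tm) [Below p n] [Below u n] : IsSg k n (dvdB p u n) := by
  unfold ArithModels.dvdB; infer_instance
instance primeB (p : Tm) [Below p n] : IsSg k n (primeB p n) := by
  unfold ArithModels.primeB; infer_instance
instance nextPrimeB (p q : Tm) [Below p n] [Below q n] : IsSg k n (nextPrimeB p q n) := by
  unfold ArithModels.nextPrimeB; infer_instance
instance powB (p e v : Tm) [Below p n] [Below e n] [Below v n] : IsSg (k + 1) n (powB p e v n) := by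
  unfold ArithModels.powB; infer_instance
instance nthPrimeB (p v : Tm) [Below p n] [Below v n] : IsSg (k + 1) n (nthPrimeB p v n) := by
  unfold ArithModels.nthPrimeB; infer_instance
instance elB (p e v : Tm) [Below p n] [Below e n] [Below v n] : IsSg (k + 1) n (elB p e v n) := by
  unfold ArithModels.elB; infer_instance
instance updB (s a j t : Tm) [Below s n] [Below a n] [Below j n] [Below t n] :
    IsSg (k + 1) n (updB s a j t n) := by
  unfold ArithModels.updB; infer_instance
instance tmWithB (P : Tm → Bd) (x : Tm) [Below x n]
    [IsSg (k + 1) (n + 6) (P (.var (n + 5)) (n + 6))] : IsSg (k + 1) n (tmWithB P x n) := by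
  unfold ArithModels.tmWithB; infer_instance
instance tmB (x : Tm) [Below x n] : IsSg (k + 1) n (tmB x n) := by
  unfold ArithModels.tmB; infer_instance
instance tmWithoutB (j x : Tm) [Below j n] [Below x n] : IsSg (k + 1) n (tmWithoutB j x n) := by
  unfold ArithModels.tmWithoutB; infer_instance
instance fmB (x : Tm) [Below x n] : IsSg (k + 1) n (fmB x n) := by
  unfold ArithModels.fmB; infer_instance
set_option synthInstance.maxSize 2000 in
set_option synthInstance.maxHeartbeats 400000 in
instance recB (E : Tm → Tm → Bd) (Z : Tm → Bd) (F : Tm → Tm → Bd) (A P : Tm → Tm → Tm → Bd)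
    (x v : Tm) [Below x n] [Below v n]
    [IsSg (k + 1) (n + 7) (E (.var (n + 5)) (.var (n + 6)) (n + 7))]
    [IsSg (k + 1) (n + 6) (Z (.var (n + 5)) (n + 6))]
    [IsSg (k + 1) (n + 8) (F (.var (n + 6)) (.var (n + 7)) (n + 8))]
    [IsSg (k + 1) (n + 10) (A (.var (n + 7)) (.var (n + 8)) (.var (n + 9)) (n + 10))]
    [IsSg (k + 1) (n + 10) (P (.var (n + 7)) (.var (n + 8)) (.var (n + 9)) (n + 10))] :
    IsSg (k + 1) n (recB E Z F A P x v n) := by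
  unfold ArithModels.recB; infer_instance
set_option synthInstance.maxSize 2000 in
set_option synthInstance.maxHeartbeats 400000 in
instance substTB (i t x v : Tm) [Below i n] [Below t n] [Below x n] [Below v n] :
    IsSg (k + 1) n (substTB i t x v n) := by
  unfold ArithModels.substTB; infer_instance
set_option synthInstance.maxSize 2000 in
set_option synthInstance.maxHeartbeats 400000 in
instance substFB (i t x v : Tm) [Below i n] [Below t n] [Below x n] [Below v n] :
    IsSg (k + 1) n (substFB i t x v n) := by
  unfold ArithModels.substFB; infer_instance
set_option synthInstance.maxSize 2000 in
set_option synthInstance.maxHeartbeats 400000 in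
instance axPAB (x : Tm) [Below x n] : IsSg (k + 1) n (axPAB x n) := by
  unfold ArithModels.axPAB ArithModels.qAxioms
  simp only [List.foldr]
  infer_instance
set_option synthInstance.maxSize 2000 in
set_option synthInstance.maxHeartbeats 400000 in
instance delta0B (x : Tm) [Below x n] : IsSg (k + 1) n (delta0B x n) := by
  unfold ArithModels.delta0B; infer_instance
instance tvalB (s x v : Tm) [Below s n] [Below x n] [Below v n] :
    IsSg (k + 1) n (tvalB s x v n) := by
  unfold ArithModels.tvalB; infer_instance
set_option synthInstance.maxSize 2000 in
set_option synthInstance.maxHeartbeats 400000 in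
instance truthB (x s v : Tm) [Below s n] [Below x n] [Below v n] :
    IsSg (k + 1) n (truthB x s v n) := by
  unfold ArithModels.truthB; infer_instance
instance stripExB (x s y v : Tm) [Below s n] [Below x n] [Below y n] [Below v n] :
    IsSg (k + 1) n (stripExB x s y v n) := by
  unfold ArithModels.stripExB; infer_instance
instance stripAllB (x s y v : Tm) [Below s n] [Below x n] [Below y n] [Below v n] :
    IsSg (k + 1) n (stripAllB x s y v n) := by
  unfold ArithModels.stripAllB; infer_instance

end IsSg
end ArithModels

-- Complexity of `Sat` and `Mod`

namespace ArithModels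

open Function
open Tm (Below)

namespace IsSg

variable {k n : ℕ}

theorem of_not {φ : Fm} (h : IsSg k n (.not φ)) : IsSg (k + 1) n φ :=
  ⟨h.lt, (h.sg.congr fun _ S _ e => S.sat_not e φ).of_not⟩

instance satPi1B (x s : Tm) [Below x n] [Below s n] : IsSg (k + 2) n (satPi1B x s n) := by
  -- The universal conjunct is Π₁: its antecedent and `truthB` are both Σ₁, and `truthB` occurs
  -- negated. A Π₁ formula is Σ₂.
  have : IsSg (k + 2) n ((ArithModels.allB fun x₂ => ArithModels.allB fun s₂ =>
      (ArithModels.stripAllB x s x₂ s₂ ⩓ ArithModels.delta0B x₂) ⇛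
        ArithModels.notB (ArithModels.truthB x₂ s₂ 0)) n) :=
    of_not (not_allB (not_allB (not_impB inferInstance (not_notB inferInstance))))
  unfold ArithModels.satPi1B; infer_instance
instance satSigma2B (x s : Tm) [Below x n] [Below s n] : IsSg (k + 2) n (satSigma2B x s n) := by
  unfold ArithModels.satSigma2B; infer_instance
instance satB (c x y : Tm) [Below c n] [Below x n] [Below y n] :
    IsSg (k + 2) n (satB c x y n) := by
  unfold ArithModels.satB; infer_instance
instance satAt1 (m : Tm) (φ : Fm) (a : Tm) [Below m n] [Below a n] :
    IsSg (k + 2) n (satAt1 m φ a n) := by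
  unfold ArithModels.satAt1; infer_instance
instance satAt2 (m : Tm) (φ : Fm) (a b : Tm) [Below m n] [Below a n] [Below b n] :
    IsSg (k + 2) n (satAt2 m φ a b n) := by
  unfold ArithModels.satAt2; infer_instance
instance satAt3 (m : Tm) (φ : Fm) (a b c : Tm) [Below m n] [Below a n] [Below b n] [Below c n] :
    IsSg (k + 2) n (satAt3 m φ a b c n) := by
  unfold ArithModels.satAt3; infer_instance
instance zeroMB (m y : Tm) [Below m n] [Below y n] : IsSg (k + 2) n (zeroMB m y n) := by
  unfold ArithModels.zeroMB; infer_instance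
instance succMB (m a y : Tm) [Below m n] [Below a n] [Below y n] :
    IsSg (k + 2) n (succMB m a y n) := by
  unfold ArithModels.succMB; infer_instance
instance addMB (m a b y : Tm) [Below m n] [Below a n] [Below b n] [Below y n] :
    IsSg (k + 2) n (addMB m a b y n) := by
  unfold ArithModels.addMB; infer_instance
instance mulMB (m a b y : Tm) [Below m n] [Below a n] [Below b n] [Below y n] :
    IsSg (k + 2) n (mulMB m a b y n) := by
  unfold ArithModels.mulMB; infer_instance
instance valMB (m s x v : Tm) [Below m n] [Below s n] [Below x n] [Below v n] :
    IsSg (k + 2) n (valMB m s x v n) := by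
  unfold ArithModels.valMB; infer_instance

theorem not_iffB' {f g : Bd} (hf : IsSg k n (f n)) (hf' : IsSg k n (.not (f n)))
    (hg : IsSg k n (g n)) (hg' : IsSg k n (.not (g n))) :
    IsSg k n (.not (ArithModels.iffB f g n)) :=
  not_andB (f := ArithModels.impB f g) (g := ArithModels.impB g f)
    (not_impB hf hg') (not_impB hg hf')

/-- An equivalence uses each side both positively and negatively, and one level higher both
polarities are available. -/
theorem not_iffB {f g : Bd} (hf : IsSg k n (f n)) (hg : IsSg k n (g n)) :
    IsSg (k + 1) n (.not (ArithModels.iffB f g n)) :=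
  not_iffB' hf.succ hf.not_succ hg.succ hg.not_succ

/-- The three hypotheses are the three occurrences of `f`, which differ in the variable tested or in
the next unused index. -/
theorem not_existsUniqueB {f : Tm → Bd} (h₁ : IsSg (k + 1) (n + 1) (f (.var n) (n + 1)))
    (h₂ : IsSg (k + 1) (n + 2) (f (.var n) (n + 2)))
    (h₃ : IsSg (k + 1) (n + 2) (f (.var (n + 1)) (n + 2))) :
    IsSg (k + 2) n (.not (existsUniqueB f n)) :=
  not_andB (exB (F := f) (n := n)).not_succ
    (not_allB (not_allB (not_impB (andB (f := f _) (g := f _)).succ (eqB _ _).not_succ)))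

theorem not_totalB (m : Tm) [Below m n] : IsSg (k + 3) n (.not (totalB m n)) :=
  not_andB (not_existsUniqueB inferInstance inferInstance inferInstance) <|
  not_andB (not_allB (not_existsUniqueB inferInstance inferInstance inferInstance)) <|
  not_andB (not_allB (not_allB (not_existsUniqueB inferInstance inferInstance inferInstance)))
    (not_allB (not_allB (not_existsUniqueB inferInstance inferInstance inferInstance)))

theorem not_modB (m : Tm) [Below m n] : IsSg (k + 3) n (.not (modB m n)) :=
  not_andB (not_totalB m) <|
  not_andB (zeroMB m 0).not_succ <|
  not_andB (not_allB <| not_allB <| not_allB <|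
    not_impB inferInstance (not_iffB inferInstance inferInstance)) <|
  not_andB (not_allB <| not_allB <| not_allB <|
    not_impB inferInstance (not_iffB inferInstance inferInstance)) <|
  not_andB (not_allB <| not_allB <| not_impB inferInstance
    -- The right side of the negation clause is itself Π₂ rather than Σ₂, so all four bounds are
    -- given directly at the third level.
    (not_iffB' inferInstance (not_succ (satB ..)) (not_succ (satB ..))
      (not_notB inferInstance))) <|
  not_andB (not_allB <| not_allB <| not_allB <|
    not_impB inferInstance (not_iffB inferInstance inferInstance))
  (not_allB <| not_allB <| not_impB inferInstance (not_succ (satB ..)))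

theorem exists_isPi {φ : Fm} (h : IsSg k n (.not φ)) : (∀ i ∈ φ.fv, i < n) ∧
    ∃ π : Fm, IsPi k π ∧ (∀ i ∈ π.fv, i < n) ∧ PAProves (.iff φ π) := by
  obtain ⟨-, π, hπ, hπ₁, hπ₂⟩ := h.sg.exists_formula
  exact ⟨h.lt, π, hπ, hπ₁, fun M S hS e => by simpa [Fm.rel] using hπ₂ M S hS e⟩

end IsSg

theorem modFm_isPi : modFm.fv ⊆ {0} ∧
    ∃ π : Fm, IsPi 3 π ∧ π.fv ⊆ {0} ∧ PAProves (Fm.iff modFm π) := by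
  obtain ⟨h, π, hπ, hπ₁, hπ₂⟩ := (IsSg.not_modB (k := 0) (n := 1) (.var 0)).exists_isPi
  have sub {s : Finset ℕ} (hs : ∀ i ∈ s, i < 1) : s ⊆ {0} := fun i hi =>
    Finset.mem_singleton.2 (Nat.lt_one_iff.1 (hs i hi))
  exact ⟨sub h, π, hπ, sub hπ₁, hπ₂⟩

end ArithModels

namespace ArithModels

open Function
open Tm (Below)

/-! ### Independence of the truth of builders from the choice of variables -/

/-- The terms `t` and `t'` have the same value in the environments `e` and `e'`, and use variables
below `n` and `n'`. -/
class SameVal (e e' : ℕ → ℕ) (n n' : ℕ) (t t' : Tm) : Prop where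
  left : Below t n
  right : Below t' n'
  val_eq : stdN.val e t = stdN.val e' t'

/-- The formulas `φ` and `φ'` have the same truth value in the environments `e` and `e'`. -/
class SameTruth (e e' : ℕ → ℕ) (φ φ' : Fm) : Prop where
  iff : stdN.Sat e φ ↔ stdN.Sat e' φ'

namespace SameVal

variable {e e' : ℕ → ℕ} {n n' : ℕ}

instance var (x : ℕ) :
    SameVal (update e n x) (update e' n' x) (n + 1) (n' + 1) (.var n) (.var n') :=
  ⟨inferInstance, inferInstance, by simp⟩
instance update (x : ℕ) (t t' : Tm) [h : SameVal e e' n n' t t'] :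
    SameVal (update e n x) (update e' n' x) (n + 1) (n' + 1) t t' :=
  have := h.left
  have := h.right
  ⟨inferInstance, inferInstance, by
    rw [stdN.val_update_of_bd h.left.1, stdN.val_update_of_bd h.right.1, h.val_eq]⟩
instance zero : SameVal e e' n n' 0 0 := ⟨inferInstance, inferInstance, rfl⟩
instance succ (t t' : Tm) [h : SameVal e e' n n' t t'] : SameVal e e' n n' t.succ t'.succ :=
  have := h.left
  have := h.right
  ⟨inferInstance, inferInstance, by simp [h.val_eq]⟩
instance num (k : ℕ) : SameVal e e' n n' (.num k) (.num k) := by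
  induction k with
  | zero => exact zero
  | succ k ih => exact succ _ _
instance add (t t' u u' : Tm) [h : SameVal e e' n n' t t'] [h' : SameVal e e' n n' u u'] :
    SameVal e e' n n' (t + u) (t' + u') :=
  have := h.left
  have := h.right
  have := h'.left
  have := h'.right
  ⟨inferInstance, inferInstance, by simp [h.val_eq, h'.val_eq]⟩
instance mul (t t' u u' : Tm) [h : SameVal e e' n n' t t'] [h' : SameVal e e' n n' u u'] :
    SameVal e e' n n' (t * u) (t' * u') :=
  have := h.left
  have := h.right
  have := h'.left
  have := h'.right
  ⟨inferInstance, inferInstance, by simp [h.val_eq, h'.val_eq]⟩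

variable {t t' u u' v v' w w' : Tm} [SameVal e e' n n' t t'] [SameVal e e' n n' u u']
  [SameVal e e' n n' v v'] [SameVal e e' n n' w w']

instance prT : SameVal e e' n n' (prT t u) (prT t' u') := by
  unfold ArithModels.prT; infer_instance
instance cVar : SameVal e e' n n' (cVar t) (cVar t') := by
  unfold ArithModels.cVar; infer_instance
instance cZero : SameVal e e' n n' cZero cZero := by
  unfold ArithModels.cZero; infer_instance
instance cSucc : SameVal e e' n n' (cSucc t) (cSucc t') := by
  unfold ArithModels.cSucc; infer_instance
instance cAdd : SameVal e e' n n' (cAdd t u) (cAdd t' u') := by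
  unfold ArithModels.cAdd; infer_instance
instance cMul : SameVal e e' n n' (cMul t u) (cMul t' u') := by
  unfold ArithModels.cMul; infer_instance
instance cEq : SameVal e e' n n' (cEq t u) (cEq t' u') := by
  unfold ArithModels.cEq; infer_instance
instance cNot : SameVal e e' n n' (cNot t) (cNot t') := by
  unfold ArithModels.cNot; infer_instance
instance cAnd : SameVal e e' n n' (cAnd t u) (cAnd t' u') := by
  unfold ArithModels.cAnd; infer_instance
instance cEx : SameVal e e' n n' (cEx t u) (cEx t' u') := by
  unfold ArithModels.cEx; infer_instance
instance cAll : SameVal e e' n n' (cAll t u) (cAll t' u') := by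
  unfold ArithModels.cAll; infer_instance
instance cLe : SameVal e e' n n' (cLe t u v) (cLe t' u' v') := by
  unfold ArithModels.cLe; infer_instance
instance cBex : SameVal e e' n n' (cBex t u v w) (cBex t' u' v' w') := by
  unfold ArithModels.cBex; infer_instance

end SameVal

namespace SameTruth

set_option synthInstance.maxSize 100000
set_option synthInstance.maxHeartbeats 0

variable {e e' : ℕ → ℕ} {n n' : ℕ} {f g f' g' : Bd} {F F' : Tm → Bd}

section

variable {t t' u u' v v' w w' : Tm}

instance eqB [h : SameVal e e' n n' t t'] [h' : SameVal e e' n n' u u'] :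
    SameTruth e e' (eqB t u n) (eqB t' u' n') :=
  ⟨by simp [ArithModels.eqB, h.val_eq, h'.val_eq]⟩

variable [SameVal e e' n n' t t'] [SameVal e e' n n' u u']
  [SameVal e e' n n' v v'] [SameVal e e' n n' w w']

instance notB [h : SameTruth e e' (f n) (f' n')] : SameTruth e e' (notB f n) (notB f' n') :=
  ⟨by simp [ArithModels.notB, h.iff]⟩
instance andB [h : SameTruth e e' (f n) (f' n')] [h' : SameTruth e e' (g n) (g' n')] :
    SameTruth e e' (andB f g n) (andB f' g' n') :=
  ⟨by simp [ArithModels.andB, h.iff, h'.iff]⟩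
instance orB [h : SameTruth e e' (f n) (f' n')] [h' : SameTruth e e' (g n) (g' n')] :
    SameTruth e e' (orB f g n) (orB f' g' n') :=
  ⟨by simp [ArithModels.orB, h.iff, h'.iff]⟩
instance impB [h : SameTruth e e' (f n) (f' n')] [h' : SameTruth e e' (g n) (g' n')] :
    SameTruth e e' (impB f g n) (impB f' g' n') :=
  ⟨by simp [ArithModels.impB, h.iff, h'.iff]⟩
instance exB [h : ∀ x, SameTruth (update e n x) (update e' n' x)
    (F (.var n) (n + 1)) (F' (.var n') (n' + 1))] : SameTruth e e' (exB F n) (exB F' n') :=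
  ⟨by simp [ArithModels.exB, fun x => (h x).iff]⟩
instance allB [h : ∀ x, SameTruth (update e n x) (update e' n' x)
    (F (.var n) (n + 1)) (F' (.var n') (n' + 1))] : SameTruth e e' (allB F n) (allB F' n') :=
  ⟨by simp [ArithModels.allB, fun x => (h x).iff]⟩
instance leB : SameTruth e e' (leB t u n) (leB t' u' n') := by
  unfold ArithModels.leB; infer_instance
instance ltB : SameTruth e e' (ltB t u n) (ltB t' u' n') := by
  unfold ArithModels.ltB; infer_instance
instance bexB [h : ∀ x, SameTruth (update e n x) (update e' n' x)
    (F (.var n) (n + 1)) (F' (.var n') (n' + 1))] :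
    SameTruth e e' (bexB t F n) (bexB t' F' n') := by
  unfold ArithModels.bexB; infer_instance
instance ballB [h : ∀ x, SameTruth (update e n x) (update e' n' x)
    (F (.var n) (n + 1)) (F' (.var n') (n' + 1))] :
    SameTruth e e' (ballB t F n) (ballB t' F' n') := by
  unfold ArithModels.ballB; infer_instance
instance betaB : SameTruth e e' (betaB t u v w n) (betaB t' u' v' w' n') := by
  unfold ArithModels.betaB; infer_instance
instance derivB {step step' : (Tm → Bd) → Tm → Bd}
    [h : ∀ c d m k y, SameTruth
      (update (update (update (update (update e n c) (n + 1) d) (n + 2) m) (n + 3) k) (n + 4) y)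
      (update (update (update (update (update e' n' c) (n' + 1) d) (n' + 2) m) (n' + 3) k)
        (n' + 4) y)
      (step (fun z => ArithModels.bexB (.var (n + 3)) fun j =>
        ArithModels.ltB j (.var (n + 3)) ⩓ ArithModels.betaB (.var n) (.var (n + 1)) j z)
        (.var (n + 4)) (n + 5))
      (step' (fun z => ArithModels.bexB (.var (n' + 3)) fun j =>
        ArithModels.ltB j (.var (n' + 3)) ⩓ ArithModels.betaB (.var n') (.var (n' + 1)) j z)
        (.var (n' + 4)) (n' + 5))] :
    SameTruth e e' (derivB step t n) (derivB step' t' n') := by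
  unfold ArithModels.derivB; infer_instance
instance dvdB : SameTruth e e' (dvdB t u n) (dvdB t' u' n') := by
  unfold ArithModels.dvdB; infer_instance
instance primeB : SameTruth e e' (primeB t n) (primeB t' n') := by
  unfold ArithModels.primeB; infer_instance
instance nextPrimeB : SameTruth e e' (nextPrimeB t u n) (nextPrimeB t' u' n') := by
  unfold ArithModels.nextPrimeB; infer_instance
instance powB : SameTruth e e' (powB t u v n) (powB t' u' v' n') := by
  unfold ArithModels.powB; infer_instance
instance nthPrimeB : SameTruth e e' (nthPrimeB t u n) (nthPrimeB t' u' n') := by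
  unfold ArithModels.nthPrimeB; infer_instance
instance elB : SameTruth e e' (elB t u v n) (elB t' u' v' n') := by
  unfold ArithModels.elB; infer_instance
instance updB : SameTruth e e' (updB t u v w n) (updB t' u' v' w' n') := by
  unfold ArithModels.updB; infer_instance
instance tmB : SameTruth e e' (tmB t n) (tmB t' n') := by
  unfold ArithModels.tmB ArithModels.tmWithB; infer_instance
instance tmWithoutB : SameTruth e e' (tmWithoutB t u n) (tmWithoutB t' u' n') := by
  unfold ArithModels.tmWithoutB ArithModels.tmWithB; infer_instance
instance delta0B : SameTruth e e' (delta0B t n) (delta0B t' n') := by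
  unfold ArithModels.delta0B; infer_instance
instance tvalB : SameTruth e e' (tvalB t u v n) (tvalB t' u' v' n') := by
  unfold ArithModels.tvalB ArithModels.recB; beta_reduce; infer_instance
instance truthB : SameTruth e e' (truthB t u v n) (truthB t' u' v' n') := by
  unfold ArithModels.truthB; infer_instance
instance stripExB : SameTruth e e' (stripExB t u v w n) (stripExB t' u' v' w' n') := by
  unfold ArithModels.stripExB; infer_instance
instance stripAllB : SameTruth e e' (stripAllB t u v w n) (stripAllB t' u' v' w' n') := by
  unfold ArithModels.stripAllB; infer_instance
instance satPi1B : SameTruth e e' (satPi1B t u n) (satPi1B t' u' n') := by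
  unfold ArithModels.satPi1B; infer_instance
instance satSigma2B : SameTruth e e' (satSigma2B t u n) (satSigma2B t' u' n') := by
  unfold ArithModels.satSigma2B; infer_instance
instance satB : SameTruth e e' (satB t u v n) (satB t' u' v' n') := by
  unfold ArithModels.satB; infer_instance

end

end SameTruth

/-- The relation `Sat(c, x, y)` in the standard model. -/
def SatN (c x y : ℕ) : Prop := stdN.Sat (listEnv [c, x, y]) satFm

/-- Each occurrence of `Sat` inside `Mod` is a different formula, because bound variables depend on
the position. The `SameTruth` instances run through the construction of two such copies in parallel
and show that only the values of the arguments matter, without analysing what `Sat` says. -/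
theorem sat_satB (e : ℕ → ℕ) (n : ℕ) (c x y : Tm) [hc : Below c n] [hx : Below x n]
    [hy : Below y n] : stdN.Sat e (satB c x y n) ↔
      SatN (stdN.val e c) (stdN.val e x) (stdN.val e y) := by
  let e' := listEnv [stdN.val e c, stdN.val e x, stdN.val e y]
  have : SameVal e e' n 3 c (.var 0) := ⟨hc, inferInstance, rfl⟩
  have : SameVal e e' n 3 x (.var 1) := ⟨hx, inferInstance, rfl⟩
  have : SameVal e e' n 3 y (.var 2) := ⟨hy, inferInstance, rfl⟩
  exact (inferInstance : SameTruth e e' (satB c x y n)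
    (satB (.var 0) (.var 1) (.var 2) 3)).iff

end ArithModels

namespace ArithModels

open Function
open Tm (Below)

/-! ### Derivations -/

/-- `x` is the last entry of a finite sequence each of whose entries `y` satisfies `step prev y`,
where `prev` holds of the earlier entries. -/
def Derivable (step : (ℕ → Prop) → ℕ → Prop) (x : ℕ) : Prop :=
  ∃ (f : ℕ → ℕ) (m : ℕ), f m = x ∧ ∀ k ≤ m, step (fun z => ∃ j < k, f j = z) (f k)

/-- A monotone step. -/
def StepMono (step : (ℕ → Prop) → ℕ → Prop) : Prop :=
  ∀ ⦃P Q : ℕ → Prop⦄, (∀ z, P z → Q z) → ∀ y, step P y → step Q y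

namespace Derivable

variable {step : (ℕ → Prop) → ℕ → Prop} {x y z : ℕ}

theorem induction (hs : StepMono step) {Q : ℕ → Prop} (hQ : ∀ y, step Q y → Q y)
    (h : Derivable step x) : Q x := by
  obtain ⟨f, m, rfl, hf⟩ := h
  have : ∀ k ≤ m, Q (f k) := fun k => by
    induction k using Nat.strong_induction_on with
    | _ k ih =>
      intro hk
      refine hQ _ (hs ?_ _ (hf k hk))
      rintro _ ⟨j, hj, rfl⟩
      exact ih j hj (hj.le.trans hk)
  exact this m le_rfl

/-- Two premises suffice, since the formation rules used below have at most two immediate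
constituents. -/
theorem of_pair (hs : StepMono step) (hx : Derivable step x) (hy : Derivable step y)
    (hz : step (fun w => w = x ∨ w = y) z) : Derivable step z := by
  obtain ⟨f, m, rfl, hf⟩ := hx
  obtain ⟨g, l, rfl, hg⟩ := hy
  -- Concatenation: `f` occupies positions `0` to `m`, `g` positions `m + 1` to `m + 1 + l`, and `z`
  -- is appended at `m + l + 2`. Monotonicity makes the extra earlier entries harmless.
  let h : ℕ → ℕ := fun i => if i ≤ m then f i else if i ≤ m + 1 + l then g (i - (m + 1)) else z
  have h₁ {i : ℕ} (hi : i ≤ m) : h i = f i := if_pos hi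
  have h₂ {i : ℕ} (hi : i ≤ l) : h (m + 1 + i) = g i := by
    simp only [h]
    rw [if_neg (by omega), if_pos (by omega), Nat.add_sub_cancel_left]
  refine ⟨h, m + l + 2, ?_, fun k hk => ?_⟩
  · simp only [h]
    rw [if_neg (by omega), if_neg (by omega)]
  have cases : k ≤ m ∨ (∃ i ≤ l, k = m + 1 + i) ∨ k = m + l + 2 := by
    by_cases h' : m < k ∧ k < m + l + 2
    · exact .inr (.inl ⟨k - (m + 1), by omega, by omega⟩)
    · omega
  rcases cases with hk | ⟨i, hi, rfl⟩ | rfl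
  · rw [h₁ hk]
    refine hs ?_ _ (hf k hk)
    rintro _ ⟨j, hj, rfl⟩
    exact ⟨j, hj, h₁ (hj.le.trans hk)⟩
  · rw [h₂ hi]
    refine hs ?_ _ (hg i hi)
    rintro _ ⟨j, hj, rfl⟩
    exact ⟨m + 1 + j, by omega, h₂ (hj.le.trans hi)⟩
  · have : h (m + l + 2) = z := by
      simp only [h]
      rw [if_neg (by omega), if_neg (by omega)]
    rw [this]
    refine hs ?_ _ hz
    rintro _ (rfl | rfl)
    · exact ⟨m, by omega, h₁ le_rfl⟩
    · exact ⟨m + 1 + l, by omega, h₂ le_rfl⟩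

theorem of_one (hs : StepMono step) (hx : Derivable step x) (hz : step (fun w => w = x) z) :
    Derivable step z :=
  of_pair hs hx hx (hs (fun _ h => .inl h) _ hz)

theorem of_none (hs : StepMono step) (hz : step (fun _ => False) z) : Derivable step z :=
  ⟨fun _ => z, 0, rfl, fun _ _ => hs (fun _ h => h.elim) _ hz⟩

end Derivable

/-- The value of the `β` function. -/
def betaN (c d i : ℕ) : ℕ := c % ((i + 1) * d + 1)

/-- The Chinese remainder construction behind `Nat.unbeta`, with its single code split into the two
parameters. -/
theorem exists_betaN (f : ℕ → ℕ) (m : ℕ) : ∃ c d, ∀ i ≤ m, betaN c d i = f i := by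
  let l := (List.range (m + 1)).map f
  refine ⟨(Nat.unbeta l).unpair.1, (Nat.unbeta l).unpair.2, fun i hi => ?_⟩
  have h := Nat.beta_unbeta_coe l ⟨i, by simp [l]; omega⟩
  simpa [Nat.beta, betaN, l] using h

theorem derivable_iff {step : (ℕ → Prop) → ℕ → Prop} (hs : StepMono step) {x : ℕ} :
    Derivable step x ↔ ∃ c d m, betaN c d m = x ∧
      ∀ k ≤ m, step (fun z => ∃ j < k, betaN c d j = z) (betaN c d k) := by
  constructor
  · rintro ⟨f, m, rfl, hf⟩
    obtain ⟨c, d, h⟩ := exists_betaN f m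
    refine ⟨c, d, m, h m le_rfl, fun k hk => ?_⟩
    rw [h k hk]
    refine hs ?_ _ (hf k hk)
    rintro _ ⟨j, hj, rfl⟩
    exact ⟨j, hj, h j (hj.le.trans hk)⟩
  · rintro ⟨c, d, m, h⟩
    exact ⟨betaN c d, m, h⟩

/-! ### Truth of the builders in the standard model -/

@[simp] theorem stdN_zero : stdN.zero = 0 := rfl
@[simp] theorem stdN_succ (a : ℕ) : stdN.succ a = a + 1 := rfl
@[simp] theorem stdN_add (a b : ℕ) : stdN.add a b = a + b := rfl
@[simp] theorem stdN_mul (a b : ℕ) : stdN.mul a b = a * b := rfl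

theorem val_update_below (e : ℕ → ℕ) (n x : ℕ) (t : Tm) [h : Below t n] :
    stdN.val (update e n x) t = stdN.val e t := stdN.val_update_of_bd h.1 e x

theorem Tm.Below.val_congr {t : Tm} {n : ℕ} (h : Below t n) {e e' : ℕ → ℕ}
    (he : ∀ i < n, e' i = e i) : stdN.val e' t = stdN.val e t :=
  stdN.val_congr fun i hi => he i (h.lt hi)

section

variable (e : ℕ → ℕ) (n : ℕ)

@[simp] theorem val_num (k : ℕ) : stdN.val e (.num k) = k := by
  induction k with
  | zero => rfl
  | succ k ih => simp [Tm.num, ih]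

@[simp] theorem val_prT (a b : Tm) :
    stdN.val e (prT a b) = pr (stdN.val e a) (stdN.val e b) := by simp [prT, pr]

theorem sat_eqB (a b : Tm) : stdN.Sat e (eqB a b n) ↔ stdN.val e a = stdN.val e b := by
  simp [eqB]
theorem sat_notB (f : Bd) : stdN.Sat e (notB f n) ↔ ¬ stdN.Sat e (f n) := by simp [notB]
theorem sat_andB (f g : Bd) :
    stdN.Sat e (andB f g n) ↔ stdN.Sat e (f n) ∧ stdN.Sat e (g n) := by simp [andB]
theorem sat_orB (f g : Bd) :
    stdN.Sat e (orB f g n) ↔ stdN.Sat e (f n) ∨ stdN.Sat e (g n) := by simp [orB]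
theorem sat_impB (f g : Bd) :
    stdN.Sat e (impB f g n) ↔ (stdN.Sat e (f n) → stdN.Sat e (g n)) := by simp [impB]
theorem sat_iffB (f g : Bd) :
    stdN.Sat e (iffB f g n) ↔ (stdN.Sat e (f n) ↔ stdN.Sat e (g n)) := by simp [iffB]
theorem sat_exB (F : Tm → Bd) : stdN.Sat e (exB F n) ↔
    ∃ x, stdN.Sat (update e n x) (F (.var n) (n + 1)) := by simp [exB]
theorem sat_allB (F : Tm → Bd) : stdN.Sat e (allB F n) ↔
    ∀ x, stdN.Sat (update e n x) (F (.var n) (n + 1)) := by simp [allB]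
theorem sat_leB (a b : Tm) [Below a n] [Below b n] :
    stdN.Sat e (leB a b n) ↔ stdN.val e a ≤ stdN.val e b := by
  simp only [stdN.sat_leB, ArithStr.le, stdN_add]
  exact ⟨fun ⟨z, hz⟩ => by omega, fun h => ⟨_, Nat.sub_add_cancel h⟩⟩
theorem sat_ltB (a b : Tm) [Below a n] [Below b n] :
    stdN.Sat e (ltB a b n) ↔ stdN.val e a < stdN.val e b := by
  rw [ltB, sat_leB, ArithStr.val_succ, stdN_succ, Nat.succ_le_iff]
theorem sat_bexB (t : Tm) (F : Tm → Bd) [Below t n] : stdN.Sat e (bexB t F n) ↔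
    ∃ x ≤ stdN.val e t, stdN.Sat (update e n x) (F (.var n) (n + 1)) := by
  simp [bexB, sat_exB, sat_andB, sat_leB, val_update_below]
theorem sat_ballB (t : Tm) (F : Tm → Bd) [Below t n] : stdN.Sat e (ballB t F n) ↔
    ∀ x ≤ stdN.val e t, stdN.Sat (update e n x) (F (.var n) (n + 1)) := by
  simp [ballB, sat_notB, sat_bexB]

end

attribute [local simp] val_update_below sat_eqB sat_notB sat_andB sat_orB sat_impB sat_iffB
  sat_exB sat_allB sat_leB sat_ltB sat_bexB sat_ballB

section

variable (e : ℕ → ℕ) (n : ℕ)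

theorem sat_betaB (c d i v : Tm) [Below c n] [Below d n] [Below i n] [Below v n] :
    stdN.Sat e (betaB c d i v n) ↔
      betaN (stdN.val e c) (stdN.val e d) (stdN.val e i) = stdN.val e v := by
  simp only [betaB, sat_andB, sat_bexB, sat_eqB, sat_leB, val_update_below, ArithStr.val_add,
    ArithStr.val_mul, ArithStr.val_succ, ArithStr.val_var, update_self, stdN_add, stdN_mul,
    stdN_succ, betaN]
  generalize stdN.val e c = c
  generalize (stdN.val e i + 1) * stdN.val e d = m
  generalize stdN.val e v = v
  constructor
  · rintro ⟨⟨q, -, rfl⟩, hv⟩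
    rw [Nat.mul_comm, Nat.mul_add_mod, Nat.mod_eq_of_lt (Nat.lt_succ_of_le hv)]
  · rintro rfl
    refine ⟨⟨c / (m + 1), Nat.div_le_self _ _, (Nat.div_add_mod' _ _).symm⟩, ?_⟩
    exact Nat.lt_succ_iff.1 (Nat.mod_lt c (Nat.succ_pos m))

end

/-- Membership among the entries before the `k`-th one of the sequence coded by `c` and `d`. -/
def Prev (c d k z : ℕ) : Prop := ∃ j < k, betaN c d j = z

theorem sat_prevB (e : ℕ → ℕ) (n m : ℕ) (z : Tm) [Below z m] [h : Below (.var (n + 3)) m] :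
    stdN.Sat e (prevB n z m) ↔ Prev (e n) (e (n + 1)) (e (n + 3)) (stdN.val e z) := by
  have := h.1
  have h₀ : Below (.var n) m := ⟨by simp at this ⊢; omega⟩
  have h₁ : Below (.var (n + 1)) m := ⟨by simp at this ⊢; omega⟩
  simp only [prevB, sat_bexB, sat_andB, sat_ltB, sat_betaB, val_update_below, ArithStr.val_var,
    update_self, Prev]
  simp only [Tm.bd_var] at this
  refine exists_congr fun j => ?_
  rw [update_of_ne (by omega), update_of_ne (by omega), update_of_ne (by omega)]
  exact ⟨fun h => h.2, fun h => ⟨h.1.le, h⟩⟩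

/-- Reduces evaluation of a recursive definition to evaluation of one step. The step is tested in
every environment agreeing with `e` on the variables in use, so parameters keep their values;
indices `n`, `n + 1`, `n + 3`, `n + 4` hold the β parameters, the position and the entry. -/
theorem sat_derivB {e : ℕ → ℕ} {n : ℕ} {step : (Tm → Bd) → Tm → Bd} {x : Tm} [Below x n]
    {stepN : (ℕ → Prop) → ℕ → Prop} (hs : StepMono stepN)
    (h : ∀ e', (∀ i < n, e' i = e i) → (stdN.Sat e' (step (prevB n) (.var (n + 4)) (n + 5)) ↔
      stepN (Prev (e' n) (e' (n + 1)) (e' (n + 3))) (e' (n + 4)))) :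
    stdN.Sat e (derivB step x n) ↔ Derivable stepN (stdN.val e x) := by
  have h' (c d m k y : ℕ) : stdN.Sat
      (update (update (update (update (update e n c) (n + 1) d) (n + 2) m) (n + 3) k) (n + 4) y)
      (step (fun z => bexB (.var (n + 3)) fun j =>
        ltB j (.var (n + 3)) ⩓ betaB (.var n) (.var (n + 1)) j z) (.var (n + 4)) (n + 5)) ↔
      stepN (Prev c d k) y := by
    have := h (update (update (update (update (update e n c) (n + 1) d) (n + 2) m)
      (n + 3) k) (n + 4) y) fun i hi => by
        simp only [update_apply]
        repeat rw [if_neg (by omega)]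
    simp only [update_self, ne_eq, Nat.add_left_cancel_iff, Nat.reduceEqDiff, Nat.left_eq_add,
      OfNat.ofNat_ne_zero, one_ne_zero, not_false_eq_true, update_of_ne] at this
    exact this
  simp [derivB, sat_betaB, derivable_iff hs, h', Nat.add_assoc]
  rfl

end ArithModels

namespace ArithModels

open Function
open Tm (Below)

attribute [local simp] val_update_below sat_eqB sat_notB sat_andB sat_orB sat_impB sat_iffB
  sat_exB sat_allB sat_leB sat_ltB sat_bexB sat_ballB sat_prevB Nat.add_assoc

-- The sum `a + b` is recovered as an integer square root: `(a + b)² + a < (a + b + 1)²`.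
@[simp] theorem pr_inj {a b c d : ℕ} : pr a b = pr c d ↔ a = c ∧ b = d := by
  refine ⟨fun h => ?_, fun ⟨h₁, h₂⟩ => h₁ ▸ h₂ ▸ rfl⟩
  have key {a b c d : ℕ} (h : pr a b = pr c d) : a + b ≤ c + d := by
    simp only [pr] at h
    by_contra hlt
    nlinarith
  have hs := le_antisymm (key h) (key h.symm)
  simp only [pr, hs] at h
  omega

/-! ### Primes, powers and coded sequences -/

section

variable (e : ℕ → ℕ) (n : ℕ)

theorem sat_dvdB (p u : Tm) [Below p n] [Below u n] :
    stdN.Sat e (dvdB p u n) ↔ stdN.val e p ∣ stdN.val e u := by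
  simp [dvdB]
  constructor
  · rintro ⟨q, -, h⟩
    exact ⟨q, by rw [← h, Nat.mul_comm]⟩
  · rintro ⟨q, h⟩
    rw [h]
    -- The quotient must be bounded by the dividend. This can fail for divisor `0`, where the
    -- quotient `0` is taken instead.
    rcases Nat.eq_zero_or_pos (stdN.val e p) with h0 | h0
    · exact ⟨0, Nat.zero_le _, by simp [h0]⟩
    · exact ⟨q, Nat.le_mul_of_pos_left _ h0, Nat.mul_comm _ _⟩

attribute [local simp] sat_dvdB

theorem sat_primeB (p : Tm) [Below p n] :
    stdN.Sat e (primeB p n) ↔ (stdN.val e p).Prime := by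
  simp [primeB, Nat.prime_def]
  intro hp
  refine forall_congr' fun q => ⟨fun h hq => h (Nat.le_of_dvd (by omega) hq) hq, fun h _ => h⟩

attribute [local simp] sat_primeB

theorem sat_nextPrimeB (p q : Tm) [Below p n] [Below q n] : stdN.Sat e (nextPrimeB p q n) ↔
    IsLeast {r | stdN.val e p < r ∧ r.Prime} (stdN.val e q) := by
  simp [nextPrimeB, IsLeast, lowerBounds, and_assoc]
  intro h₁ h₂
  constructor
  · intro h r h₃ h₄
    by_contra h₅
    exact h₅ (h r (by omega) h₃ h₄).ge
  · intro h r h₃ h₄ h₅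
    exact le_antisymm h₃ (h h₄ h₅)

attribute [local simp] sat_nextPrimeB

/-- The pattern for the recursive definitions that follow: induction on derivations shows that only
correct entries are derivable, and recursion on the argument builds a derivation of each correct
entry. -/
theorem sat_powB (p a v : Tm) [Below p n] [Below a n] [Below v n] :
    stdN.Sat e (powB p a v n) ↔ stdN.val e p ^ stdN.val e a = stdN.val e v := by
  set q := stdN.val e p with hq
  let step : (ℕ → Prop) → ℕ → Prop := fun P y =>
    y = pr 0 1 ∨ ∃ i w, P (pr i w) ∧ y = pr (i + 1) (w * q)
  have hs : StepMono step := by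
    rintro P Q h y (h' | ⟨i, w, h₁, h₂⟩)
    · exact .inl h'
    · exact .inr ⟨i, w, h _ h₁, h₂⟩
  rw [powB, sat_derivB hs]
  · rw [val_prT]
    constructor
    · intro h
      have := h.induction hs (Q := fun y => ∃ i, y = pr i (q ^ i)) (by
        rintro y (rfl | ⟨i, w, ⟨j, hj⟩, rfl⟩)
        · exact ⟨0, by simp⟩
        · rw [pr_inj] at hj
          exact ⟨i + 1, by rw [hj.2, ← hj.1, pow_succ]⟩)
      obtain ⟨i, hi⟩ := this
      rw [pr_inj] at hi
      rw [hi.2, hi.1]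
    · rintro h
      rw [← h]
      induction stdN.val e a with
      | zero => exact .of_none hs (.inl (by simp))
      | succ i ih => exact .of_one hs ih (.inr ⟨i, q ^ i, rfl, by rw [pow_succ]⟩)
  · intro e' he
    have : stdN.val e' p = q := Below.val_congr inferInstance he
    simp [step, this]

theorem sat_nthPrimeB (k p : Tm) [Below p n] [Below k n] :
    stdN.Sat e (nthPrimeB k p n) ↔ Nat.nth Nat.Prime (stdN.val e k) = stdN.val e p := by
  let step : (ℕ → Prop) → ℕ → Prop := fun P y =>
    y = pr 0 2 ∨ ∃ i q r, P (pr i q) ∧ IsLeast {s | q < s ∧ s.Prime} r ∧ y = pr (i + 1) r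
  have hs : StepMono step := by
    rintro P Q h y (h' | ⟨i, q, r, h₁, h₂⟩)
    · exact .inl h'
    · exact .inr ⟨i, q, r, h _ h₁, h₂⟩
  -- Every prime above the `i`-th is the `j`-th for some `j > i`.
  have next (i : ℕ) : IsLeast {s | Nat.nth Nat.Prime i < s ∧ s.Prime}
      (Nat.nth Nat.Prime (i + 1)) := by
    refine ⟨⟨Nat.nth_strictMono Nat.infinite_setOfPred_prime (Nat.lt_succ_self i),
      Nat.prime_nth_prime _⟩, fun s hs => ?_⟩
    obtain ⟨j, rfl⟩ : ∃ j, Nat.nth Nat.Prime j = s := ⟨_, Nat.nth_count hs.2⟩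
    have := (Nat.nth_lt_nth Nat.infinite_setOfPred_prime).1 hs.1
    exact (Nat.nth_le_nth Nat.infinite_setOfPred_prime).2 this
  rw [nthPrimeB, sat_derivB hs]
  · rw [val_prT]
    constructor
    · intro h
      have := h.induction hs (Q := fun y => ∃ i, y = pr i (Nat.nth Nat.Prime i)) (by
        rintro y (rfl | ⟨i, q, r, ⟨j, hj⟩, hr, rfl⟩)
        · exact ⟨0, by simp [Nat.nth_prime_zero_eq_two]⟩
        · rw [pr_inj] at hj
          obtain ⟨rfl, rfl⟩ := hj
          exact ⟨i + 1, by rw [hr.unique (next i)]⟩)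
      obtain ⟨i, hi⟩ := this
      rw [pr_inj] at hi
      rw [hi.2, hi.1]
    · rintro h
      rw [← h]
      induction stdN.val e k with
      | zero => exact .of_none hs (.inl (by simp [Nat.nth_prime_zero_eq_two]))
      | succ i ih => exact .of_one hs ih (.inr ⟨i, _, _, rfl, next i, rfl⟩)
  · intro e' he
    simp [step]

end

theorem factorization_mul_pow {p u a : ℕ} (hp : p.Prime) (hu : ¬ p ∣ u) :
    (u * p ^ a).factorization p = a := by
  have hu0 : u ≠ 0 := fun h => hu (h ▸ dvd_zero p)
  rw [Nat.factorization_mul hu0 (pow_ne_zero _ hp.ne_zero), Finsupp.add_apply,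
    Nat.factorization_eq_zero_of_not_dvd hu, hp.factorization_pow]
  simp

theorem exists_eq_mul_pow {p : ℕ} (hp : p.Prime) (s : ℕ) :
    ∃ u, s + 1 = u * p ^ (s + 1).factorization p ∧ ¬ p ∣ u :=
  ⟨(s + 1) / p ^ (s + 1).factorization p,
    (Nat.div_mul_cancel (Nat.ordProj_dvd _ _)).symm,
    Nat.not_dvd_ordCompl hp (Nat.succ_ne_zero s)⟩

/-- `upd s k a` codes the same sequence as `s`, except that the `k`-th entry is `a`. -/
noncomputable def upd (s k a : ℕ) : ℕ :=
  (s + 1) / Nat.nth Nat.Prime k ^ el s k * Nat.nth Nat.Prime k ^ a - 1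

theorem upd_succ {s k a u : ℕ} (h : s + 1 = u * Nat.nth Nat.Prime k ^ el s k) :
    upd s k a + 1 = u * Nat.nth Nat.Prime k ^ a := by
  have hp : 0 < Nat.nth Nat.Prime k := (Nat.prime_nth_prime k).pos
  have hu : 0 < u := by
    rcases Nat.eq_zero_or_pos u with rfl | hu
    · simp at h
    · exact hu
  rw [upd, h, Nat.mul_div_cancel _ (pow_pos hp _)]
  exact Nat.sub_add_cancel (Nat.mul_pos hu (pow_pos hp _))

/-- With `s + 1 = u · p_k ^ el s k` and `p_k ∤ u`, only the power of `p_k` is exchanged, and the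
exponents of the other primes come from `u`. This matches the arithmetized quantifier clause with
Tarski's. -/
theorem el_upd (s k a : ℕ) : el (upd s k a) = update (el s) k a := by
  have hp := Nat.prime_nth_prime k
  obtain ⟨u, h₁, h₂⟩ := exists_eq_mul_pow hp s
  have hu0 : u ≠ 0 := fun h => h₂ (h ▸ dvd_zero _)
  funext i
  by_cases hi : i = k
  · subst hi
    rw [update_self, el, upd_succ h₁, factorization_mul_pow hp h₂]
  · have hne : Nat.nth Nat.Prime i ≠ Nat.nth Nat.Prime k := fun h =>
      hi (Nat.nth_injective Nat.infinite_setOfPred_prime h)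
    rw [update_of_ne hi, el, upd_succ h₁, el, h₁,
      Nat.factorization_mul hu0 (pow_ne_zero _ hp.ne_zero),
      Nat.factorization_mul hu0 (pow_ne_zero _ hp.ne_zero), Finsupp.add_apply, Finsupp.add_apply,
      hp.factorization_pow, hp.factorization_pow, Finsupp.single_eq_of_ne hne,
      Finsupp.single_eq_of_ne hne]

section

variable (e : ℕ → ℕ) (n : ℕ)

attribute [local simp] sat_dvdB sat_powB sat_nthPrimeB

theorem sat_elB (s k a : Tm) [Below s n] [Below k n] [Below a n] :
    stdN.Sat e (elB s k a n) ↔ el (stdN.val e s) (stdN.val e k) = stdN.val e a := by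
  simp [elB]
  have hp := Nat.prime_nth_prime (stdN.val e k)
  constructor
  · rintro ⟨u, h₁, h₂⟩
    rw [el, h₁, factorization_mul_pow hp h₂]
  · intro h
    rw [← h]
    exact exists_eq_mul_pow hp _

theorem sat_updB (s a k t : Tm) [Below s n] [Below k n] [Below a n] [Below t n] :
    stdN.Sat e (updB s a k t n) ↔
      stdN.val e t = upd (stdN.val e s) (stdN.val e k) (stdN.val e a) := by
  simp [updB]
  have hp := Nat.prime_nth_prime (stdN.val e k)
  constructor
  · rintro ⟨u, ⟨b, h₁⟩, h₂, h₃⟩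
    have : el (stdN.val e s) (stdN.val e k) = b := by rw [el, h₁, factorization_mul_pow hp h₂]
    rw [← this] at h₁
    have := upd_succ (a := stdN.val e a) h₁
    omega
  · intro h
    obtain ⟨u, h₁, h₂⟩ := exists_eq_mul_pow hp (stdN.val e s)
    exact ⟨u, ⟨_, h₁⟩, h₂, by rw [h]; exact upd_succ h₁⟩

end

end ArithModels

namespace ArithModels

open Function
open Tm (Below)

attribute [local simp] val_update_below sat_eqB sat_notB sat_andB sat_orB sat_impB sat_iffB
  sat_exB sat_allB sat_leB sat_ltB sat_bexB sat_ballB sat_prevB Nat.add_assoc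

/-! ### Arithmetized syntax in the standard model -/

attribute [local simp] cVar cZero cSucc cAdd cMul cEq cNot cAnd cEx

theorem Tm.gn_injective : Injective Tm.gn := by
  intro a
  induction a with
  | var i =>
    intro b h
    cases b <;> simp [Tm.gn] at h ⊢
    exact h
  | zero => intro b h; cases b <;> simp [Tm.gn] at h ⊢
  | succ a ih =>
    intro b h
    cases b <;> simp [Tm.gn] at h ⊢
    exact ih h
  | add a b iha ihb | mul a b iha ihb =>
    intro c h
    cases c <;> simp [Tm.gn] at h ⊢
    exact ⟨iha h.1, ihb h.2⟩

theorem Fm.gn_injective : Injective Fm.gn := by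
  intro a
  induction a with
  | eq a b =>
    intro c h
    cases c <;> simp [Fm.gn] at h ⊢
    exact ⟨Tm.gn_injective h.1, Tm.gn_injective h.2⟩
  | not a ih =>
    intro b h
    cases b <;> simp [Fm.gn] at h ⊢
    exact ih h
  | and a b iha ihb =>
    intro c h
    cases c <;> simp [Fm.gn] at h ⊢
    exact ⟨iha h.1, ihb h.2⟩
  | ex i a ih =>
    intro b h
    cases b <;> simp [Fm.gn] at h ⊢
    exact ⟨h.1, ih h.2⟩

@[simp] theorem val_quoteT (e : ℕ → ℕ) (t : Tm) : stdN.val e (quoteT t) = t.gn := by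
  induction t <;> simp_all [quoteT, Tm.gn]

@[simp] theorem val_quoteF (e : ℕ → ℕ) (φ : Fm) : stdN.val e (quoteF φ) = φ.gn := by
  induction φ <;> simp_all [quoteF, Fm.gn]

section

variable (e : ℕ → ℕ) (n : ℕ)

theorem sat_tmB (x : Tm) [Below x n] :
    stdN.Sat e (tmB x n) ↔ ∃ t : Tm, t.gn = stdN.val e x := by
  let step : (ℕ → Prop) → ℕ → Prop := fun P y =>
    (∃ k, y = pr 1 k) ∨ y = pr 2 0 ∨ (∃ a, P a ∧ y = pr 3 a) ∨
      ∃ a b, P a ∧ P b ∧ (y = pr 4 (pr a b) ∨ y = pr 5 (pr a b))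
  have hs : StepMono step := by
    rintro P Q h y (h' | h' | ⟨a, h₁, h₂⟩ | ⟨a, b, h₁, h₂, h₃⟩)
    · exact .inl h'
    · exact .inr (.inl h')
    · exact .inr (.inr (.inl ⟨a, h _ h₁, h₂⟩))
    · exact .inr (.inr (.inr ⟨a, b, h _ h₁, h _ h₂, h₃⟩))
  rw [tmB, tmWithB, sat_derivB hs]
  · constructor
    · refine Derivable.induction hs (Q := fun y => ∃ t : Tm, t.gn = y) ?_
      rintro y (⟨k, rfl⟩ | rfl | ⟨_, ⟨a, rfl⟩, rfl⟩ | ⟨_, _, ⟨a, rfl⟩, ⟨b, rfl⟩, rfl | rfl⟩)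
      · exact ⟨.var k, rfl⟩
      · exact ⟨.zero, rfl⟩
      · exact ⟨.succ a, rfl⟩
      · exact ⟨.add a b, rfl⟩
      · exact ⟨.mul a b, rfl⟩
    · rintro ⟨t, ht⟩
      rw [← ht]
      clear ht
      induction t with
      | var k => exact .of_none hs (.inl ⟨k, rfl⟩)
      | zero => exact .of_none hs (.inr (.inl rfl))
      | succ a ih => exact .of_one hs ih (.inr (.inr (.inl ⟨_, rfl, rfl⟩)))
      | add a b iha ihb =>
        exact .of_pair hs iha ihb (.inr (.inr (.inr ⟨_, _, .inl rfl, .inr rfl, .inl rfl⟩)))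
      | mul a b iha ihb =>
        exact .of_pair hs iha ihb (.inr (.inr (.inr ⟨_, _, .inl rfl, .inr rfl, .inr rfl⟩)))
  · intro e' he
    simp [step]

attribute [local simp] sat_tmB

theorem sat_fmB (x : Tm) [Below x n] :
    stdN.Sat e (fmB x n) ↔ ∃ φ : Fm, φ.gn = stdN.val e x := by
  let step : (ℕ → Prop) → ℕ → Prop := fun P y =>
    (∃ a b, (∃ t : Tm, t.gn = a) ∧ (∃ t : Tm, t.gn = b) ∧ y = pr 6 (pr a b)) ∨
      (∃ a, P a ∧ y = pr 7 a) ∨ (∃ a b, P a ∧ P b ∧ y = pr 8 (pr a b)) ∨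
        ∃ i a, P a ∧ y = pr 9 (pr i a)
  have hs : StepMono step := by
    rintro P Q h y (h' | ⟨a, h₁, h₂⟩ | ⟨a, b, h₁, h₂, h₃⟩ | ⟨i, a, h₁, h₂⟩)
    · exact .inl h'
    · exact .inr (.inl ⟨a, h _ h₁, h₂⟩)
    · exact .inr (.inr (.inl ⟨a, b, h _ h₁, h _ h₂, h₃⟩))
    · exact .inr (.inr (.inr ⟨i, a, h _ h₁, h₂⟩))
  rw [fmB, sat_derivB hs]
  · constructor
    · refine Derivable.induction hs (Q := fun y => ∃ φ : Fm, φ.gn = y) ?_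
      rintro y (⟨_, _, ⟨a, rfl⟩, ⟨b, rfl⟩, rfl⟩ | ⟨_, ⟨a, rfl⟩, rfl⟩ |
        ⟨_, _, ⟨a, rfl⟩, ⟨b, rfl⟩, rfl⟩ | ⟨i, _, ⟨a, rfl⟩, rfl⟩)
      · exact ⟨.eq a b, rfl⟩
      · exact ⟨.not a, rfl⟩
      · exact ⟨.and a b, rfl⟩
      · exact ⟨.ex i a, rfl⟩
    · rintro ⟨t, ht⟩
      rw [← ht]
      clear ht
      induction t with
      | eq a b => exact .of_none hs (.inl ⟨_, _, ⟨a, rfl⟩, ⟨b, rfl⟩, rfl⟩)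
      | not a ih => exact .of_one hs ih (.inr (.inl ⟨_, rfl, rfl⟩))
      | and a b iha ihb =>
        exact .of_pair hs iha ihb (.inr (.inr (.inl ⟨_, _, .inl rfl, .inr rfl, rfl⟩)))
      | ex i a ih => exact .of_one hs ih (.inr (.inr (.inr ⟨_, _, rfl, rfl⟩)))
  · intro e' he
    simp [step]

end

/-- Evaluation of arithmetized terms in a structure with domain `ℕ`. -/
theorem sat_recB {e : ℕ → ℕ} {n : ℕ} (S : ArithStr ℕ) (env : ℕ → ℕ) {E : Tm → Tm → Bd}
    {Z : Tm → Bd} {F : Tm → Tm → Bd} {A P : Tm → Tm → Tm → Bd} {x v : Tm} [Below x n] [Below v n]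
    (hE : ∀ e', (∀ i < n, e' i = e i) → (stdN.Sat e' (E (.var (n + 5)) (.var (n + 6)) (n + 7)) ↔
      e' (n + 6) = env (e' (n + 5))))
    (hZ : ∀ e', (∀ i < n, e' i = e i) → (stdN.Sat e' (Z (.var (n + 5)) (n + 6)) ↔
      e' (n + 5) = S.zero))
    (hF : ∀ e', (∀ i < n, e' i = e i) → (stdN.Sat e' (F (.var (n + 6)) (.var (n + 7)) (n + 8)) ↔
      e' (n + 7) = S.succ (e' (n + 6))))
    (hA : ∀ e', (∀ i < n, e' i = e i) →
      (stdN.Sat e' (A (.var (n + 7)) (.var (n + 8)) (.var (n + 9)) (n + 10)) ↔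
        e' (n + 9) = S.add (e' (n + 7)) (e' (n + 8))))
    (hP : ∀ e', (∀ i < n, e' i = e i) →
      (stdN.Sat e' (P (.var (n + 7)) (.var (n + 8)) (.var (n + 9)) (n + 10)) ↔
        e' (n + 9) = S.mul (e' (n + 7)) (e' (n + 8)))) :
    stdN.Sat e (recB E Z F A P x v n) ↔
      ∃ t : Tm, t.gn = stdN.val e x ∧ stdN.val e v = S.val env t := by
  let step : (ℕ → Prop) → ℕ → Prop := fun Q y =>
    (∃ k w, w = env k ∧ y = pr (pr 1 k) w) ∨ (∃ w, w = S.zero ∧ y = pr (pr 2 0) w) ∨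
      (∃ a u w, Q (pr a u) ∧ w = S.succ u ∧ y = pr (pr 3 a) w) ∨
      ∃ a b u u₂ w, Q (pr a u) ∧ Q (pr b u₂) ∧
        ((w = S.add u u₂ ∧ y = pr (pr 4 (pr a b)) w) ∨ (w = S.mul u u₂ ∧ y = pr (pr 5 (pr a b)) w))
  have hs : StepMono step := by
    rintro Q R h y (h' | h' | ⟨a, u, w, h₁, h₂⟩ | ⟨a, b, u, u₂, w, h₁, h₂, h₃⟩)
    · exact .inl h'
    · exact .inr (.inl h')
    · exact .inr (.inr (.inl ⟨a, u, w, h _ h₁, h₂⟩))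
    · exact .inr (.inr (.inr ⟨a, b, u, u₂, w, h _ h₁, h _ h₂, h₃⟩))
  rw [recB, sat_derivB hs]
  · rw [val_prT]
    constructor
    · intro h
      have := h.induction hs (Q := fun y => ∃ t : Tm, y = pr t.gn (S.val env t)) (by
        rintro y (⟨k, w, rfl, rfl⟩ | ⟨w, rfl, rfl⟩ | ⟨a, u, w, ⟨t, ht⟩, rfl, rfl⟩ |
          ⟨a, b, u, u₂, w, ⟨t, ht⟩, ⟨t', ht'⟩, ⟨rfl, rfl⟩ | ⟨rfl, rfl⟩⟩)
        · exact ⟨.var k, rfl⟩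
        · exact ⟨.zero, rfl⟩
        · obtain ⟨rfl, rfl⟩ := pr_inj.1 ht
          exact ⟨.succ t, rfl⟩
        · obtain ⟨rfl, rfl⟩ := pr_inj.1 ht
          obtain ⟨rfl, rfl⟩ := pr_inj.1 ht'
          exact ⟨.add t t', rfl⟩
        · obtain ⟨rfl, rfl⟩ := pr_inj.1 ht
          obtain ⟨rfl, rfl⟩ := pr_inj.1 ht'
          exact ⟨.mul t t', rfl⟩)
      obtain ⟨t, ht⟩ := this
      obtain ⟨h₁, h₂⟩ := pr_inj.1 ht
      exact ⟨t, h₁.symm, h₂⟩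
    · rintro ⟨t, h₁, h₂⟩
      rw [← h₁, h₂]
      clear h₁ h₂
      induction t with
      | var k => exact .of_none hs (.inl ⟨k, _, rfl, rfl⟩)
      | zero => exact .of_none hs (.inr (.inl ⟨_, rfl, rfl⟩))
      | succ a ih => exact .of_one hs ih (.inr (.inr (.inl ⟨_, _, _, rfl, rfl, rfl⟩)))
      | add a b iha ihb =>
        exact .of_pair hs iha ihb
          (.inr (.inr (.inr ⟨_, _, _, _, _, .inl rfl, .inr rfl, .inl ⟨rfl, rfl⟩⟩)))
      | mul a b iha ihb =>
        exact .of_pair hs iha ihb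
          (.inr (.inr (.inr ⟨_, _, _, _, _, .inl rfl, .inr rfl, .inr ⟨rfl, rfl⟩⟩)))
  · intro e' he
    have agree {e'' : ℕ → ℕ} (h : ∀ i < n, e'' i = e' i) : ∀ i < n, e'' i = e i :=
      fun i hi => (h i hi).trans (he i hi)
    have hE' (k w : ℕ) : stdN.Sat (update (update e' (n + 5) k) (n + 6) w)
        (E (.var (n + 5)) (.var (n + 6)) (n + 7)) ↔ w = env k := by
      rw [hE _ (agree fun i hi => ?_)]
      · simp
      · simp only [update_apply]
        repeat rw [if_neg (by omega)]
    have hZ' (w : ℕ) : stdN.Sat (update e' (n + 5) w) (Z (.var (n + 5)) (n + 6)) ↔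
        w = S.zero := by
      rw [hZ _ (agree fun i hi => ?_)]
      · simp
      · simp only [update_apply]
        repeat rw [if_neg (by omega)]
    have hF' (a u w : ℕ) : stdN.Sat (update (update (update e' (n + 5) a) (n + 6) u) (n + 7) w)
        (F (.var (n + 6)) (.var (n + 7)) (n + 8)) ↔ w = S.succ u := by
      rw [hF _ (agree fun i hi => ?_)]
      · simp
      · simp only [update_apply]
        repeat rw [if_neg (by omega)]
    have hA' (a b u u₂ w : ℕ) : stdN.Sat (update (update (update (update (update e' (n + 5) a)
        (n + 6) b) (n + 7) u) (n + 8) u₂) (n + 9) w)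
        (A (.var (n + 7)) (.var (n + 8)) (.var (n + 9)) (n + 10)) ↔ w = S.add u u₂ := by
      rw [hA _ (agree fun i hi => ?_)]
      · simp
      · simp only [update_apply]
        repeat rw [if_neg (by omega)]
    have hP' (a b u u₂ w : ℕ) : stdN.Sat (update (update (update (update (update e' (n + 5) a)
        (n + 6) b) (n + 7) u) (n + 8) u₂) (n + 9) w)
        (P (.var (n + 7)) (.var (n + 8)) (.var (n + 9)) (n + 10)) ↔ w = S.mul u u₂ := by
      rw [hP _ (agree fun i hi => ?_)]
      · simp
      · simp only [update_apply]
        repeat rw [if_neg (by omega)]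
    simp [step, hE', hZ', hF', hA', hP']

end ArithModels

namespace ArithModels

open Function
open Tm (Below)

attribute [local simp] val_update_below sat_eqB sat_notB sat_andB sat_orB sat_impB sat_iffB
  sat_exB sat_allB sat_leB sat_ltB sat_bexB sat_ballB sat_prevB Nat.add_assoc sat_tmB sat_fmB
  sat_elB sat_updB sat_satB

attribute [local simp] cVar cZero cSucc cAdd cMul cEq cNot cAnd cEx cImp cAll

/-! ### Arithmetized substitution -/

/-- The term constructors as operations on Gödel numbers. -/
def codeStr : ArithStr ℕ :=
  ⟨pr 2 0, pr 3, fun a b => pr 4 (pr a b), fun a b => pr 5 (pr a b)⟩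

/-- Substitution into a term is evaluation in the structure of codes, so `sat_recB` covers both
arithmetized substitution and arithmetized evaluation. -/
theorem val_codeStr (i : ℕ) (t a : Tm) :
    codeStr.val (fun k => if k = i then t.gn else pr 1 k) a = (Tm.subst i t a).gn := by
  induction a with
  | var k => by_cases h : k = i <;> simp [Tm.subst, h, Tm.gn]
  | zero => rfl
  | succ a ih => simp [Tm.subst, ih, Tm.gn]; rfl
  | add a b iha ihb | mul a b iha ihb => simp [Tm.subst, iha, ihb, Tm.gn]; rfl

theorem sat_substTB (e : ℕ → ℕ) (n : ℕ) (i t x v : Tm) [Below i n] [Below t n] [Below x n]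
    [Below v n] {t' : Tm} (ht : stdN.val e t = t'.gn) :
    stdN.Sat e (substTB i t x v n) ↔ ∃ a : Tm, a.gn = stdN.val e x ∧
      stdN.val e v = (Tm.subst (stdN.val e i) t' a).gn := by
  rw [substTB, sat_recB codeStr fun k => if k = stdN.val e i then t'.gn else pr 1 k]
  · simp only [val_codeStr]
  · intro e' he
    have h₁ : stdN.val e' i = stdN.val e i := Below.val_congr inferInstance he
    have h₂ : stdN.val e' t = stdN.val e t := Below.val_congr inferInstance he
    by_cases h : e' (n + 5) = stdN.val e i <;> simp [h₁, h₂, ht, h]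
  all_goals
    intro e' he
    simp [codeStr]

theorem sat_substFB (e : ℕ → ℕ) (n : ℕ) (i t x v : Tm) [Below i n] [Below t n] [Below x n]
    [Below v n] {t' : Tm} (ht : stdN.val e t = t'.gn) :
    stdN.Sat e (substFB i t x v n) ↔ ∃ φ : Fm, φ.gn = stdN.val e x ∧
      stdN.val e v = (φ.subst (stdN.val e i) t').gn := by
  set j := stdN.val e i with hj
  let step : (ℕ → Prop) → ℕ → Prop := fun P y =>
    (∃ a b a₂ b₂, (∃ s : Tm, s.gn = a ∧ a₂ = (Tm.subst j t' s).gn) ∧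
      (∃ s : Tm, s.gn = b ∧ b₂ = (Tm.subst j t' s).gn) ∧
      y = pr (pr 6 (pr a b)) (pr 6 (pr a₂ b₂))) ∨
    (∃ a a₂, P (pr a a₂) ∧ y = pr (pr 7 a) (pr 7 a₂)) ∨
    (∃ a b a₂ b₂, P (pr a a₂) ∧ P (pr b b₂) ∧ y = pr (pr 8 (pr a b)) (pr 8 (pr a₂ b₂))) ∨
    (∃ a, (∃ φ : Fm, φ.gn = a) ∧ y = pr (pr 9 (pr j a)) (pr 9 (pr j a))) ∨
    ∃ k a a₂, k ≠ j ∧ P (pr a a₂) ∧ y = pr (pr 9 (pr k a)) (pr 9 (pr k a₂))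
  have hs : StepMono step := by
    rintro P Q h y (h' | ⟨a, a₂, h₁, h₂⟩ | ⟨a, b, a₂, b₂, h₁, h₂, h₃⟩ | h' | ⟨k, a, a₂, h₁, h₂, h₃⟩)
    · exact .inl h'
    · exact .inr (.inl ⟨a, a₂, h _ h₁, h₂⟩)
    · exact .inr (.inr (.inl ⟨a, b, a₂, b₂, h _ h₁, h _ h₂, h₃⟩))
    · exact .inr (.inr (.inr (.inl h')))
    · exact .inr (.inr (.inr (.inr ⟨k, a, a₂, h₁, h _ h₂, h₃⟩)))
  rw [substFB, sat_derivB hs]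
  · rw [val_prT]
    constructor
    · intro h
      have := h.induction hs (Q := fun y => ∃ φ : Fm, y = pr φ.gn (φ.subst j t').gn) (by
        rintro y (⟨_, _, _, _, ⟨a, rfl, rfl⟩, ⟨b, rfl, rfl⟩, rfl⟩ | ⟨a, a₂, ⟨φ, hφ⟩, rfl⟩ |
          ⟨a, b, a₂, b₂, ⟨φ, hφ⟩, ⟨ψ, hψ⟩, rfl⟩ | ⟨_, ⟨φ, rfl⟩, rfl⟩ | ⟨k, a, a₂, hk, ⟨φ, hφ⟩, rfl⟩)
        · exact ⟨.eq a b, rfl⟩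
        · obtain ⟨rfl, rfl⟩ := pr_inj.1 hφ
          exact ⟨.not φ, rfl⟩
        · obtain ⟨rfl, rfl⟩ := pr_inj.1 hφ
          obtain ⟨rfl, rfl⟩ := pr_inj.1 hψ
          exact ⟨.and φ ψ, rfl⟩
        · exact ⟨.ex j φ, by simp [Fm.subst, Fm.gn]⟩
        · obtain ⟨rfl, rfl⟩ := pr_inj.1 hφ
          exact ⟨.ex k φ, by simp [Fm.subst, Fm.gn, hk]⟩)
      obtain ⟨φ, hφ⟩ := this
      obtain ⟨h₁, h₂⟩ := pr_inj.1 hφ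
      exact ⟨φ, h₁.symm, h₂⟩
    · rintro ⟨φ, h₁, h₂⟩
      rw [← h₁, h₂]
      clear h₁ h₂
      induction φ with
      | eq a b => exact .of_none hs (.inl ⟨_, _, _, _, ⟨a, rfl, rfl⟩, ⟨b, rfl, rfl⟩, rfl⟩)
      | not φ ih => exact .of_one hs ih (.inr (.inl ⟨_, _, rfl, rfl⟩))
      | and φ ψ ih₁ ih₂ =>
        exact .of_pair hs ih₁ ih₂ (.inr (.inr (.inl ⟨_, _, _, _, .inl rfl, .inr rfl, rfl⟩)))
      | ex k φ ih =>
        -- A quantifier over the substituted variable leaves the formula unchanged and has its own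
        -- rule, without premise.
        by_cases hk : k = j
        · refine .of_none hs (.inr (.inr (.inr (.inl ⟨_, ⟨φ, rfl⟩, ?_⟩))))
          simp [Fm.subst, Fm.gn, hk]
        · refine .of_one hs ih (.inr (.inr (.inr (.inr ⟨k, _, _, hk, rfl, ?_⟩))))
          simp [Fm.subst, Fm.gn, hk]
  · intro e' he
    have h₁ : stdN.val e' i = j := Below.val_congr inferInstance he
    have h₂ : stdN.val e' t = t'.gn := (Below.val_congr inferInstance he).trans ht
    have hsub (a b c d : ℕ) (u v : Tm) [Below u (n + 9)] [Below v (n + 9)] :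
        stdN.Sat (update (update (update (update e' (n + 5) a) (n + 6) b) (n + 7) c) (n + 8) d)
          (substTB i t u v (n + 9)) ↔ ∃ s : Tm, s.gn = stdN.val (update (update (update
            (update e' (n + 5) a) (n + 6) b) (n + 7) c) (n + 8) d) u ∧
          stdN.val (update (update (update (update e' (n + 5) a) (n + 6) b) (n + 7) c)
            (n + 8) d) v = (Tm.subst j t' s).gn := by
      rw [sat_substTB _ _ i t u v (t' := t') (by simp [h₂])]
      simp [h₁]
    simp [step, hsub, h₁]

theorem sat_substFB_zero (e : ℕ → ℕ) (n : ℕ) (i x v : Tm) [Below i n] [Below x n] [Below v n] :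
    stdN.Sat e (substFB i cZero x v n) ↔ ∃ φ : Fm, φ.gn = stdN.val e x ∧
      stdN.val e v = (φ.subst (stdN.val e i) 0).gn :=
  sat_substFB e n i cZero x v (by simp; rfl)

theorem sat_substFB_succ (e : ℕ → ℕ) (n : ℕ) (i x v : Tm) [Below i n] [Below x n] [Below v n] :
    stdN.Sat e (substFB i (cSucc (cVar i)) x v n) ↔ ∃ φ : Fm, φ.gn = stdN.val e x ∧
      stdN.val e v = (φ.subst (stdN.val e i) (.succ (.var (stdN.val e i)))).gn :=
  sat_substFB e n i (cSucc (cVar i)) x v (by simp; rfl)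

theorem sat_axPAB (e : ℕ → ℕ) (n : ℕ) (x : Tm) [Below x n] :
    stdN.Sat e (axPAB x n) ↔ ∃ φ ∈ PA, φ.gn = stdN.val e x := by
  have hq (l : List Fm) : stdN.Sat e (l.foldr (fun φ f => x ≐ quoteF φ ⩔ f) (0 ≐ .num 1) n) ↔
      ∃ φ ∈ l, φ.gn = stdN.val e x := by
    induction l with
    | nil => simp
    | cons φ l ih => simp [ih, eq_comm]
  rw [axPAB, sat_orB, hq]
  simp only [sat_exB, sat_andB, sat_fmB, sat_substFB_zero, sat_substFB_succ, sat_eqB]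
  simp
  constructor
  · rintro (⟨φ, hφ, h⟩ | ⟨i, φ, a, h, φ₁, h₁, hx⟩)
    · exact ⟨φ, .inl hφ, h⟩
    · obtain rfl := Fm.gn_injective h
      -- The two substitution clauses each supply their own formula; injectivity of Gödel numbers
      -- identifies them with the induction formula.
      obtain rfl := Fm.gn_injective h₁
      exact ⟨_, .inr ⟨i, φ₁, rfl⟩, Eq.trans (by rfl) hx.symm⟩
  · rintro ⟨φ, hφ | ⟨i, ψ, rfl⟩, h⟩
    · exact .inl ⟨φ, hφ, h⟩
    · exact .inr ⟨i, ψ, ψ, rfl, ψ, rfl, h.symm.trans (by rfl)⟩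

end ArithModels

namespace ArithModels

open Function
open Tm (Below)

attribute [local simp] val_update_below sat_eqB sat_notB sat_andB sat_orB sat_impB sat_iffB
  sat_exB sat_allB sat_leB sat_ltB sat_bexB sat_ballB sat_prevB Nat.add_assoc sat_tmB sat_fmB
  sat_elB sat_updB sat_satB sat_axPAB

attribute [local simp] cEq cNot cAnd cEx

/-! ### Codes of models -/

/-- `SatN m φ 0[a/0]`. -/
def SatN1 (m : ℕ) (φ : Fm) (a : ℕ) : Prop := SatN m φ.gn (upd 0 0 a)
/-- `SatN m φ 0[a/0, b/1]`. -/
def SatN2 (m : ℕ) (φ : Fm) (a b : ℕ) : Prop := SatN m φ.gn (upd (upd 0 0 a) 1 b)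
/-- `SatN m φ 0[a/0, b/1, c/2]`. -/
def SatN3 (m : ℕ) (φ : Fm) (a b c : ℕ) : Prop := SatN m φ.gn (upd (upd (upd 0 0 a) 1 b) 2 c)

/-- The formulas `0 = x_0`, `S(x_0) = x_1`, `x_0 + x_1 = x_2` and `x_0 · x_1 = x_2` define, in the
predicate coded by `m`, the graphs of the operations of `S`. -/
structure Interprets (m : ℕ) (S : ArithStr ℕ) : Prop where
  zero (y : ℕ) : SatN1 m (.eq 0 (.var 0)) y ↔ y = S.zero
  succ (a y : ℕ) : SatN2 m (.eq (.succ (.var 0)) (.var 1)) a y ↔ y = S.succ a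
  add (a b y : ℕ) : SatN3 m (.eq (.var 0 + .var 1) (.var 2)) a b y ↔ y = S.add a b
  mul (a b y : ℕ) : SatN3 m (.eq (.var 0 * .var 1) (.var 2)) a b y ↔ y = S.mul a b

section

variable (e : ℕ → ℕ) (n : ℕ)

theorem sat_zeroMB (m y : Tm) [Below m n] [Below y n] : stdN.Sat e (zeroMB m y n) ↔
    SatN1 (stdN.val e m) (.eq 0 (.var 0)) (stdN.val e y) := by
  simp [zeroMB, satAt1, SatN1]

theorem sat_succMB (m a y : Tm) [Below m n] [Below a n] [Below y n] :
    stdN.Sat e (succMB m a y n) ↔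
      SatN2 (stdN.val e m) (.eq (.succ (.var 0)) (.var 1)) (stdN.val e a) (stdN.val e y) := by
  simp [succMB, satAt2, SatN2]

theorem sat_addMB (m a b y : Tm) [Below m n] [Below a n] [Below b n] [Below y n] :
    stdN.Sat e (addMB m a b y n) ↔ SatN3 (stdN.val e m) (.eq (.var 0 + .var 1) (.var 2))
      (stdN.val e a) (stdN.val e b) (stdN.val e y) := by
  simp [addMB, satAt3, SatN3]

theorem sat_mulMB (m a b y : Tm) [Below m n] [Below a n] [Below b n] [Below y n] :
    stdN.Sat e (mulMB m a b y n) ↔ SatN3 (stdN.val e m) (.eq (.var 0 * .var 1) (.var 2))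
      (stdN.val e a) (stdN.val e b) (stdN.val e y) := by
  simp [mulMB, satAt3, SatN3]

attribute [local simp] sat_zeroMB sat_succMB sat_addMB sat_mulMB

/-- The existence halves of the clauses allow the operations to be chosen; the uniqueness halves
make the given predicates exactly their graphs. -/
theorem sat_totalB (m : Tm) [Below m n] : stdN.Sat e (totalB m n) ↔
    ∃ S, Interprets (stdN.val e m) S := by
  simp [totalB, existsUniqueB]
  constructor
  · rintro ⟨⟨⟨z, hz⟩, hz'⟩, hs', ha', hp'⟩
    choose s hs using fun x => (hs' x).1
    choose a ha using fun x y => (ha' x y).1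
    choose p hp using fun x y => (hp' x y).1
    refine ⟨⟨z, s, a, p⟩, fun y => ⟨fun h => hz' _ _ h hz, ?_⟩,
      fun x y => ⟨fun h => (hs' x).2 _ _ h (hs x), ?_⟩,
      fun x y w => ⟨fun h => (ha' x y).2 _ _ h (ha x y), ?_⟩,
      fun x y w => ⟨fun h => (hp' x y).2 _ _ h (hp x y), ?_⟩⟩
    · rintro rfl; exact hz
    · rintro rfl; exact hs x
    · rintro rfl; exact ha x y
    · rintro rfl; exact hp x y
  · rintro ⟨S, h⟩
    simp [h.zero, h.succ, h.add, h.mul]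

theorem sat_valMB (m s x v : Tm) [Below m n] [Below s n] [Below x n] [Below v n] {S : ArithStr ℕ}
    (h : Interprets (stdN.val e m) S) : stdN.Sat e (valMB m s x v n) ↔
      ∃ t : Tm, t.gn = stdN.val e x ∧ stdN.val e v = S.val (el (stdN.val e s)) t := by
  rw [valMB, sat_recB S (el (stdN.val e s))]
  all_goals
    intro e' he
    have h₁ : stdN.val e' s = stdN.val e s := Below.val_congr inferInstance he
    have h₂ : stdN.val e' m = stdN.val e m := Below.val_congr inferInstance he
    simp [h₁, h₂, h.zero, h.succ, h.add, h.mul, eq_comm]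

/-- Once a structure is attached to `m`, arithmetized terms and formulas can be replaced by genuine
ones, since every number passing the syntactic tests is a Gödel number. -/
theorem sat_modB (m : Tm) [Below m n] {S : ArithStr ℕ} (h : Interprets (stdN.val e m) S) :
    stdN.Sat e (modB m n) ↔ S.zero = 0 ∧
      (∀ (i : ℕ) (φ : Fm) (s : ℕ), SatN (stdN.val e m) (Fm.ex i φ).gn s ↔
        ∃ x, SatN (stdN.val e m) φ.gn (upd s i x)) ∧
      (∀ (φ ψ : Fm) (s : ℕ), SatN (stdN.val e m) (Fm.and φ ψ).gn s ↔
        SatN (stdN.val e m) φ.gn s ∧ SatN (stdN.val e m) ψ.gn s) ∧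
      (∀ (φ : Fm) (s : ℕ), SatN (stdN.val e m) (Fm.not φ).gn s ↔ ¬ SatN (stdN.val e m) φ.gn s) ∧
      (∀ (a b : Tm) (s : ℕ), SatN (stdN.val e m) (Fm.eq a b).gn s ↔
        S.val (el s) a = S.val (el s) b) ∧
      (∀ φ ∈ PA, ∀ s, SatN (stdN.val e m) φ.gn s) := by
  have hv (a b s v : ℕ) (t u : Tm) [Below t (n + 4)] [Below u (n + 4)] :
      stdN.Sat (update (update (update (update e n a) (n + 1) b) (n + 2) s) (n + 3) v)
        (valMB m t u (.var (n + 3)) (n + 4)) ↔ ∃ w : Tm,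
          w.gn = stdN.val (update (update (update (update e n a) (n + 1) b) (n + 2) s) (n + 3) v) u
          ∧ v = S.val (el (stdN.val (update (update (update (update e n a) (n + 1) b) (n + 2) s)
            (n + 3) v) t)) w := by
    rw [sat_valMB _ _ m t u _ (by simpa using h)]
    simp
  rw [modB, sat_andB, sat_totalB]
  simp [hv, h.zero, Fm.gn]
  constructor
  · rintro ⟨-, h0, h1, h2, h3, h4, h5⟩
    exact ⟨h0.symm, fun i φ s => h1 i _ s φ rfl, fun φ ψ s => h2 _ _ s φ rfl ψ rfl,
      fun φ s => h3 _ s φ rfl,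
      -- Having a common value means equality of values, because the terms are determined by their
      -- Gödel numbers.
      fun a b s => (h4 _ _ s a rfl b rfl).trans (by simp [Tm.gn_injective.eq_iff]),
      fun φ hφ s => h5 _ s φ rfl φ hφ rfl⟩
  · rintro ⟨h0, h1, h2, h3, h4, h5⟩
    refine ⟨⟨S, h⟩, h0.symm, ?_, ?_, ?_, ?_, ?_⟩
    · rintro i _ s φ rfl
      exact h1 i φ s
    · rintro _ _ s φ rfl ψ rfl
      exact h2 φ ψ s
    · rintro _ s φ rfl
      exact h3 φ s
    · rintro _ _ s a rfl b rfl
      exact (h4 a b s).trans (by simp [Tm.gn_injective.eq_iff])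
    · rintro _ s φ rfl ψ hψ hφ
      exact hφ ▸ h5 ψ hψ s

end

-- From codes to models and back

theorem IsCode.satN_iff {m : ℕ} {S : ArithStr ℕ} (h : IsCode m S) (φ : Fm) (s : ℕ) :
    SatN m φ.gn s ↔ S.Sat (el s) φ := (h φ s).symm

theorem IsCode.interprets {m : ℕ} {S : ArithStr ℕ} (h : IsCode m S) : Interprets m S where
  zero y := by simp [SatN1, h.satN_iff, el_upd, eq_comm]
  succ a y := by simp [SatN2, h.satN_iff, el_upd, eq_comm]
  add a b y := by simp [SatN3, h.satN_iff, el_upd, eq_comm]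
  mul a b y := by simp [SatN3, h.satN_iff, el_upd, eq_comm]

theorem Interprets.unique {m : ℕ} {S S' : ArithStr ℕ} (h : Interprets m S)
    (h' : Interprets m S') : S = S' := by
  obtain ⟨z, s, a, p⟩ := S
  obtain ⟨z', s', a', p'⟩ := S'
  congr 1
  · exact (h'.zero z).1 ((h.zero z).2 rfl)
  · funext x
    exact (h'.succ x _).1 ((h.succ x _).2 rfl)
  · funext x y
    exact (h'.add x y _).1 ((h.add x y _).2 rfl)
  · funext x y
    exact (h'.mul x y _).1 ((h.mul x y _).2 rfl)

theorem IsCode.sat_modFm {m : ℕ} {S : ArithStr ℕ} (h : IsCode m S) (hS : IsSigma2Model S) :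
    stdN.Sat (listEnv [m]) modFm := by
  refine (sat_modB (listEnv [m]) 1 (.var 0) (S := S) h.interprets).2 ?_
  change S.zero = 0 ∧
      (∀ (i : ℕ) (φ : Fm) (s : ℕ), SatN m (Fm.ex i φ).gn s ↔ ∃ x, SatN m φ.gn (upd s i x)) ∧
      (∀ (φ ψ : Fm) (s : ℕ), SatN m (Fm.and φ ψ).gn s ↔ SatN m φ.gn s ∧ SatN m ψ.gn s) ∧
      (∀ (φ : Fm) (s : ℕ), SatN m (Fm.not φ).gn s ↔ ¬ SatN m φ.gn s) ∧
      (∀ (a b : Tm) (s : ℕ), SatN m (Fm.eq a b).gn s ↔ S.val (el s) a = S.val (el s) b) ∧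
      (∀ φ ∈ PA, ∀ s, SatN m φ.gn s)
  simp only [h.satN_iff, el_upd]
  exact ⟨hS.zero_eq, fun _ _ _ => S.sat_ex _ _ _, fun _ _ _ => S.sat_and _ _ _,
    fun _ _ => S.sat_not _ _, fun _ _ _ => S.sat_eq _ _ _, fun φ hφ s => hS.models φ hφ _⟩

theorem exists_el_eq (e : ℕ → ℕ) (n : ℕ) : ∃ s, ∀ i < n, el s i = e i := by
  induction n with
  | zero => exact ⟨0, fun i hi => absurd hi (Nat.not_lt_zero i)⟩
  | succ n ih =>
    obtain ⟨s, hs⟩ := ih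
    refine ⟨upd s n (e n), fun i hi => ?_⟩
    rw [el_upd]
    by_cases h : i = n
    · simp [h]
    · rw [update_of_ne h]
      exact hs i (by omega)

/-- Coded sequences have finite support, while a model of PA must satisfy the axioms in arbitrary
environments; agreement on the finitely many free variables bridges the gap. -/
theorem exists_sat_el_iff {S : ArithStr ℕ} (e : ℕ → ℕ) (φ : Fm) :
    ∃ s, S.Sat (el s) φ ↔ S.Sat e φ := by
  obtain ⟨s, hs⟩ := exists_el_eq e (φ.fv.sup id + 1)
  exact ⟨s, S.sat_congr fun i hi =>
    hs i (Nat.lt_succ_of_le (Finset.le_sup (f := id) hi))⟩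

theorem IsCode.sigma2 {m : ℕ} {S : ArithStr ℕ} (h : IsCode m S) :
    SigmaDefinablePairs 2 {q | ∃ (φ : Fm) (s : ℕ), q = (φ.gn, s) ∧ S.SatCode φ s} := by
  -- The code `m` enters as a numeral. The conjunct `fmB` discards first components that are not
  -- Gödel numbers of formulas, on which `IsCode` places no restriction.
  have hsg : IsSg 2 2 ((fmB (.var 0) ⩓ satB (.num m) (.var 0) (.var 1)) 2) := inferInstance
  obtain ⟨⟨ψ, hψ, hψn, hiff⟩, -⟩ := hsg.sg.exists_formula
  refine ⟨ψ, hψ, fun i hi => ?_, fun a b => ?_⟩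
  · have := hψn i hi
    simp
    omega
  · have : stdN.Sat (listEnv [a, b]) ψ ↔ _ := (hiff ℕ stdN stdN_modelsPA (listEnv [a, b])).symm
    rw [this, Fm.rel]
    simp only [sat_andB, sat_fmB, sat_satB, val_num, ArithStr.val_var]
    change (∃ (φ : Fm) (s : ℕ), (a, b) = (φ.gn, s) ∧ S.Sat (el s) φ) ↔
      (∃ φ : Fm, φ.gn = a) ∧ SatN m a b
    constructor
    · rintro ⟨φ, s, hq, hφ⟩
      obtain ⟨rfl, rfl⟩ := Prod.mk.inj hq
      exact ⟨⟨φ, rfl⟩, (h.satN_iff _ _).2 hφ⟩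
    · rintro ⟨⟨φ, rfl⟩, hφ⟩
      exact ⟨φ, b, rfl, (h.satN_iff _ _).1 hφ⟩

theorem exists_isCode_of_sat_modFm {m : ℕ} (h : stdN.Sat (listEnv [m]) modFm) :
    ∃ S, IsSigma2Model S ∧ IsCode m S := by
  obtain ⟨S, hS⟩ : ∃ S, Interprets m S :=
    (sat_totalB (listEnv [m]) 1 (.var 0)).1 ((sat_andB _ _ _ _).1 h).1
  obtain ⟨hz, hex, hand, hnot, heq, hPA⟩ := (sat_modB (listEnv [m]) 1 (.var 0) (S := S) hS).1 h
  -- The Tarski conditions are the recursion clauses of satisfaction. The environment code stays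
  -- universally quantified, because the quantifier case changes it.
  have key (φ : Fm) : ∀ s, SatN m φ.gn s ↔ S.Sat (el s) φ := by
    induction φ with
    | eq a b => exact fun s => (heq a b s).trans (S.sat_eq _ _ _).symm
    | not φ ih => exact fun s => (hnot φ s).trans (by rw [S.sat_not, ← ih]; rfl)
    | and φ ψ ih₁ ih₂ => exact fun s => (hand φ ψ s).trans (by rw [S.sat_and, ← ih₁, ← ih₂]; rfl)
    | ex i φ ih =>
      refine fun s => (hex i φ s).trans ?_
      rw [S.sat_ex]
      refine exists_congr fun x => ?_
      rw [← el_upd, ← ih]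
      rfl
  have hcode : IsCode m S := fun φ s => (key φ s).symm
  refine ⟨S, ⟨fun φ hφ e => ?_, hz, hcode.sigma2⟩, hcode⟩
  -- `Mod` gives the axioms for coded environments only, so `e` is replaced by a coded one that
  -- agrees with it on the free variables of `φ`.
  obtain ⟨s, hs⟩ := exists_sat_el_iff (S := S) e φ
  exact hs.1 ((key φ s).1 (hPA φ hφ s))

end ArithModels

theorem proposition5p4 :
    (ArithModels.modFm.fv ⊆ {0} ∧
      ∃ π : ArithModels.Fm, ArithModels.IsPi 3 π ∧ π.fv ⊆ {0} ∧
        ArithModels.PAProves (ArithModels.Fm.iff ArithModels.modFm π)) ∧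
    (∀ (M : ArithModels.ArithStr ℕ), ArithModels.IsSigma2Model M →
      ∀ m : ℕ, ArithModels.IsCode m M →
        ArithModels.stdN.Sat (ArithModels.listEnv [m]) ArithModels.modFm) ∧
    (∀ m : ℕ, ArithModels.stdN.Sat (ArithModels.listEnv [m]) ArithModels.modFm →
      ∃! M : ArithModels.ArithStr ℕ,
        ArithModels.IsSigma2Model M ∧ ArithModels.IsCode m M) := by
  refine ⟨ArithModels.modFm_isPi, fun M hM m hm => hm.sat_modFm hM, fun m h => ?_⟩
  obtain ⟨M, hM, hm⟩ := ArithModels.exists_isCode_of_sat_modFm h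
  exact ⟨M, ⟨hM, hm⟩, fun M' h' => h'.2.interprets.unique hm.interprets⟩
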